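/- Let $(\mathcal S,\mathcal A,P,\rho,\gamma,r_{1:m})$ be a finite discounted MDP with $|\mathcal A|\ge 2$, $\gamma\in(0,1)$ and reward functions $r_i:\mathcal S\times\mathcal A\to[0,1]$, $i=1,\dots,m$. For a stationary policy $\pi$ and $r:\mathcal S\times\mathcal A\to\mathbb R$ let $V_r^\pi(\rho)=\mathbb E[\sum_{t\ge0}\gamma^t r(s_t,a_t)\mid s_0\sim\rho,\pi]$, $V^\pi_{1:m}(\rho)=(V^\pi_{r_1}(\rho),\dots,V^\pi_{r_m}(\rho))$, and let $d_\rho^\pi(s,a)=(1-\gamma)\sum_{t\ge0}\gamma^t\,\mathbb P(s_t=s,a_t=a\mid s_0\sim\rho,\pi)$, $d_\rho^\pi(s)=\sum_a d_\rho^\pi(s,a)$, be the discounted visitation distributions. For $\theta\in\mathbb R^{\mathcal S\times\mathcal A}$ let $\pi_\theta(a|s)=e^{\theta_{s,a}}/\sum_{a'}e^{\theta_{s,a'}}$. Let $F$ be concave and differentiable on $[0,\frac1{1-\gamma}]^m$, with $\|\nabla F(v)-\nabla F(v')\|_1\le\beta\|v-v'\|_\infty$ and $\|\nabla F(v)\|_1\le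 L$ there, where $\beta,L>0$. Let $\pi^*$ be an optimal policy for $\max_\theta F(V^{\pi_\theta}_{1:m}(\rho))$, i.e. a stationary policy with $F(V_{1:m}^{\pi^*}(\rho))=\sup_\theta F(V_{1:m}^{\pi_\theta}(\rho))$. ARNPG-IMD with parameters $K\ge1$, $\alpha\ge\frac{\beta}{(1-\gamma)^3}$, $\eta=\frac{1-\gamma}{\alpha}$ and $t_k=\lceil\frac1{1-\gamma}\log(\frac{5LK}{\beta\log|\mathcal A|})+1\rceil$ (replaced by $0$ if negative) is the following algorithm. Start from $\theta_0$ such that $\pi_{\theta_0}$ is the uniform policy. For $k=0,\dots,K-1$ put $\tilde r_k(s,a)=\langle\nabla F(V_{1:m}^{\pi_{\theta_k}}(\rho)),r_{1:m}(s,a)\rangle$ and $$\tilde V_k(\theta)=V_{\tilde r_k}^{\pi_\theta}(\rho)-\frac{\alpha}{1-\gamma}\sum_s d_\rho^{\pi_\theta}(s)\sum_a\pi_\theta(a|s)\log\frac{\pi_\theta(a|s)}{\pi_{\theta_k}(a|s)},$$ and let $\theta_{k+1}$ be the result of $t_k$ natural policy gradient (NPG) steps $\theta\leftarrow\theta+\eta\,\mathcal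 F_\rho(\theta)^\dagger\nabla\tilde V_k(\theta)$ started at $\theta_k$, where $\mathcal F_\rho(\theta)^\dagger$ is the Moore–Penrose inverse of $\mathcal F_\rho(\theta)=\mathbb E_{(s,a)\sim d_\rho^{\pi_\theta}}[\nabla_\theta\log\pi_\theta(a|s)\,\nabla_\theta\log\pi_\theta(a|s)^\top]$. Write $\pi_k=\pi_{\theta_k}$, and let $T=\sum_{k=0}^{K-1}t_k$ be the total number of NPG iterations. Then the average optimality gap satisfies $$F(V_{1:m}^{\pi^*}(\rho))-\frac1K\sum_{k=1}^KF(V_{1:m}^{\pi_k}(\rho))=O\Big(\frac{\beta\log T}{(1-\gamma)^5\,T}\Big).$$ Precisely: for every integer $n\ge2$ and all real $\kappa>0$, $c\ge1$ there is a constant $C>0$, depending only on $n,\kappa,c$, such that the left-hand side is at most $C\,\frac{\beta\log T}{(1-\gamma)^5T}$ in every instance as above with $|\mathcal A|=n$, $L\le\kappa\beta$, $\alpha\le c\,\frac{\beta}{(1-\gamma)^3}$ and $T\ge2$. -/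

import Mathlib

open scoped Matrix

/-! ### The Moore–Penrose inverse of a real square matrix -/

/-- `X` satisfies the four Penrose equations for the real matrix `A`. -/
structure IsMoorePenrose {n : Type*} [Fintype n] (A X : Matrix n n ℝ) : Prop where
  mul_mul_left : A * X * A = A
  mul_mul_right : X * A * X = X
  symm_left : (A * X)ᵀ = A * X
  symm_right : (X * A)ᵀ = X * A

theorem IsMoorePenrose.unique {n : Type*} [Fintype n] {A X Y : Matrix n n ℝ}
    (hX : IsMoorePenrose A X) (hY : IsMoorePenrose A Y) : X = Y := by
  have h1 : A * X = A * Y := by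
    calc A * X = (A * X)ᵀ := hX.symm_left.symm
      _ = ((A * Y) * (A * X))ᵀ := by
          rw [← Matrix.mul_assoc (A * Y) A X, hY.mul_mul_left]
      _ = (A * X) * (A * Y) := by
          rw [Matrix.transpose_mul, hX.symm_left, hY.symm_left]
      _ = A * Y := by rw [← Matrix.mul_assoc (A * X) A Y, hX.mul_mul_left]
  have h2 : X * A = Y * A := by
    calc X * A = (X * A)ᵀ := hX.symm_right.symm
      _ = ((X * A) * (Y * A))ᵀ := by
          rw [Matrix.mul_assoc X A (Y * A), ← Matrix.mul_assoc A Y A, hY.mul_mul_left]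
      _ = (Y * A) * (X * A) := by
          rw [Matrix.transpose_mul, hX.symm_right, hY.symm_right]
      _ = Y * A := by
          rw [Matrix.mul_assoc Y A (X * A), ← Matrix.mul_assoc A X A, hX.mul_mul_left]
  calc X = X * A * X := hX.mul_mul_right.symm
    _ = Y * A * X := by rw [h2]
    _ = Y * (A * X) := Matrix.mul_assoc _ _ _
    _ = Y * (A * Y) := by rw [h1]
    _ = Y * A * Y := (Matrix.mul_assoc _ _ _).symm
    _ = Y := hY.mul_mul_right

theorem exists_isMoorePenrose_of_symm {n : Type*} [Fintype n] (H : Matrix n n ℝ) (hH : Hᵀ = H) :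
    ∃ X : Matrix n n ℝ, IsMoorePenrose H X ∧ Xᵀ = X := by
  classical
  have hh : H.IsHermitian := by
    rw [Matrix.IsHermitian, Matrix.conjTranspose_eq_transpose_of_trivial, hH]
  obtain ⟨U, d, hU, hUH⟩ : ∃ (U : Matrix n n ℝ) (d : n → ℝ), Uᵀ * U = 1 ∧
      H = U * Matrix.diagonal d * Uᵀ := by
    refine ⟨hh.eigenvectorUnitary, hh.eigenvalues, ?_, ?_⟩
    · have := Unitary.coe_star_mul_self hh.eigenvectorUnitary
      simpa [Matrix.star_eq_conjTranspose] using this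
    · have := hh.spectral_theorem
      rw [Unitary.conjStarAlgAut_apply] at this
      simpa [Matrix.star_eq_conjTranspose, Function.comp_def] using this
  have key : ∀ a b : n → ℝ, (U * Matrix.diagonal a * Uᵀ) * (U * Matrix.diagonal b * Uᵀ) =
      U * Matrix.diagonal (fun i => a i * b i) * Uᵀ := by
    intro a b
    rw [← Matrix.diagonal_mul_diagonal]
    calc _ = U * Matrix.diagonal a * (Uᵀ * U) * Matrix.diagonal b * Uᵀ := by
            simp only [Matrix.mul_assoc]
      _ = _ := by rw [hU]; simp only [Matrix.mul_assoc, Matrix.mul_one]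
  have sym : ∀ a : n → ℝ, (U * Matrix.diagonal a * Uᵀ)ᵀ = U * Matrix.diagonal a * Uᵀ := by
    intro a
    simp [Matrix.transpose_mul, Matrix.mul_assoc]
  refine ⟨U * Matrix.diagonal (fun i => (d i)⁻¹) * Uᵀ, ⟨?_, ?_, ?_, ?_⟩, sym _⟩
  · rw [hUH, key, key]; congr 3; funext i
    by_cases h : d i = 0 <;> simp [h]
  · rw [hUH, key, key]; congr 3; funext i
    by_cases h : d i = 0 <;> simp [h]
  · rw [hUH, key, sym]
  · rw [hUH, key, sym]

theorem exists_isMoorePenrose {n : Type*} [Fintype n] (A : Matrix n n ℝ) :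
    ∃ X : Matrix n n ℝ, IsMoorePenrose A X := by
  classical
  obtain ⟨Y, hY, hYs⟩ := exists_isMoorePenrose_of_symm (Aᵀ * A) (by simp)
  refine ⟨Y * Aᵀ, ⟨?_, ?_, ?_, ?_⟩⟩
  · have h0 : Aᵀ * A * (Y * (Aᵀ * A) - 1) = 0 := by
      rw [Matrix.mul_sub, ← Matrix.mul_assoc, hY.mul_mul_left, Matrix.mul_one, sub_self]
    have h1 : A * (Y * (Aᵀ * A) - 1) = 0 := by
      rw [← Matrix.conjTranspose_eq_transpose_of_trivial] at h0 ⊢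
      exact (Matrix.conjTranspose_mul_self_mul_eq_zero A _).1 h0
    rw [Matrix.mul_sub, Matrix.mul_one, sub_eq_zero] at h1
    simpa only [Matrix.mul_assoc] using h1
  · have h1 := congrArg (· * Aᵀ) hY.mul_mul_right
    simpa only [Matrix.mul_assoc] using h1
  · simp [Matrix.transpose_mul, hYs, Matrix.mul_assoc]
  · have h1 := hY.symm_right
    simpa only [Matrix.mul_assoc] using h1

/-- The Moore–Penrose inverse: the unique solution of the Penrose equations. -/
noncomputable def moorePenrose {n : Type*} [Fintype n] (A : Matrix n n ℝ) : Matrix n n ℝ :=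
  Classical.choose (exists_isMoorePenrose A)

/-! ### Finite discounted Markov decision processes with several rewards -/

/-- A finite discounted MDP `(S, A, P, ρ, γ, r₁, …, r_m)` with `m` reward functions. -/
structure MOMDP (S A : Type*) [Fintype S] [Fintype A] (m : ℕ) where
  /-- `P s a s'` is the probability of moving from `s` to `s'` under action `a`. -/
  P : S → A → S → ℝ
  P_mem : ∀ s a, P s a ∈ stdSimplex ℝ S
  /-- The initial state distribution. -/
  ρ : S → ℝ
  ρ_mem : ρ ∈ stdSimplex ℝ S
  /-- The discount factor. -/
  γ : ℝ
  γ_pos : 0 < γ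
  γ_lt_one : γ < 1
  /-- The reward functions. -/
  r : Fin m → S → A → ℝ
  r_mem : ∀ i s a, r i s a ∈ Set.Icc (0 : ℝ) 1

/-- `π s a` is the probability of choosing `a` in state `s`; `π` is a (stationary) policy if each
`π s` is a probability vector. -/
def IsPolicy {S A : Type*} [Fintype A] (π : S → A → ℝ) : Prop :=
  ∀ s, π s ∈ stdSimplex ℝ A

/-- The softmax policy with parameter `θ ∈ ℝ^{S × A}`. -/
noncomputable def softmax {S A : Type*} [Fintype A] (θ : S × A → ℝ) : S → A → ℝ :=
  fun s a => Real.exp (θ (s, a)) / ∑ a', Real.exp (θ (s, a'))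

/-- `D(x || y) = ∑ i, x i log (x i / y i)`. -/
noncomputable def kl {A : Type*} [Fintype A] (x y : A → ℝ) : ℝ :=
  ∑ a, x a * Real.log (x a / y a)

/-- `D_d(π || π') = ∑ s, d s · D(π(·|s) || π'(·|s))`. -/
noncomputable def policyKL {S A : Type*} [Fintype S] [Fintype A] (d : S → ℝ) (π π' : S → A → ℝ) :
    ℝ :=
  ∑ s, d s * kl (π s) (π' s)

/-- The gradient (vector of partial derivatives) of a function on `ℝ^ι`. -/
noncomputable def coordGrad {ι : Type*} [Fintype ι] [DecidableEq ι] (f : (ι → ℝ) → ℝ)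
    (x : ι → ℝ) : ι → ℝ :=
  fun i => fderiv ℝ f x (Pi.single i 1)

/-- The coordinate gradient of `F` on a set `B` (a full-dimensional box below, so that the
derivative within `B` is unique; it equals the usual gradient wherever `F` is differentiable). -/
noncomputable def coordGradWithin {m : ℕ} (F : (Fin m → ℝ) → ℝ) (B : Set (Fin m → ℝ))
    (v : Fin m → ℝ) : Fin m → ℝ :=
  fun i => fderivWithin ℝ F B v (Pi.single i 1)

namespace MOMDP

variable {S A : Type*} [Fintype S] [Fintype A] {m : ℕ}

/-- `M.stateProb π s₀ t s = ℙ(s_t = s | s_0 = s₀, π)` for the Markov chain induced by `π`. -/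
noncomputable def stateProb [DecidableEq S] (M : MOMDP S A m) (π : S → A → ℝ) (s₀ : S) : ℕ → S → ℝ
  | 0, s => if s = s₀ then 1 else 0
  | t + 1, s => ∑ s', ∑ a', M.stateProb π s₀ t s' * π s' a' * M.P s' a' s

/-- `ℙ(s_t = s, a_t = a | s_0 = s₀, π)`. -/
noncomputable def stateActionProb [DecidableEq S] (M : MOMDP S A m) (π : S → A → ℝ) (s₀ : S)
    (t : ℕ) (s : S) (a : A) : ℝ :=
  M.stateProb π s₀ t s * π s a

/-- The state value function of a reward `R`, `V_R^π(s₀) = 𝔼[∑ t, γ^t R(s_t, a_t) | s_0 = s₀, π]`,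
for an arbitrary real-valued reward on the finite set `S × A`. -/
noncomputable def value [DecidableEq S] (M : MOMDP S A m) (R : S → A → ℝ) (π : S → A → ℝ)
    (s₀ : S) : ℝ :=
  ∑' t : ℕ, M.γ ^ t * ∑ s, ∑ a, M.stateActionProb π s₀ t s a * R s a

/-- `V_R^π(ρ) = 𝔼_{s ∼ ρ} V_R^π(s)`. -/
noncomputable def valueInit [DecidableEq S] (M : MOMDP S A m) (R : S → A → ℝ) (π : S → A → ℝ) : ℝ :=
  ∑ s₀, M.ρ s₀ * M.value R π s₀

/-- The value vector `V_{1:m}^π(ρ)`. -/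
noncomputable def valueVec [DecidableEq S] (M : MOMDP S A m) (π : S → A → ℝ) : Fin m → ℝ :=
  fun i => M.valueInit (M.r i) π

/-- The discounted state-action visitation distribution `d_ρ^π(s, a)`. -/
noncomputable def visitation [DecidableEq S] (M : MOMDP S A m) (π : S → A → ℝ) (s : S) (a : A) : ℝ :=
  (1 - M.γ) * ∑ s₀, M.ρ s₀ * ∑' t : ℕ, M.γ ^ t * M.stateActionProb π s₀ t s a

/-- The discounted state visitation distribution `d_ρ^π(s)`. -/
noncomputable def stateVisitation [DecidableEq S] (M : MOMDP S A m) (π : S → A → ℝ) (s : S) : ℝ :=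
  ∑ a, M.visitation π s a

/-- The box `[0, 1/(1-γ)]^m`, which contains all achievable value vectors. -/
def valueBox (M : MOMDP S A m) : Set (Fin m → ℝ) :=
  Set.Icc 0 (fun _ => 1 / (1 - M.γ))

/-- `π` attains the optimal value of `max_θ F(V_{1:m}^{π_θ}(ρ))` over softmax policies. It may be a
boundary policy, since the supremum over softmax policies need not be attained by one of them. -/
def IsOptimal [DecidableEq S] (M : MOMDP S A m) (F : (Fin m → ℝ) → ℝ) (π : S → A → ℝ) : Prop :=
  IsPolicy π ∧
    IsLUB (Set.range fun θ : S × A → ℝ => F (M.valueVec (softmax θ))) (F (M.valueVec π))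

/-- The KL-regularized value with anchor `θk`:
`V_R^{π_θ}(ρ) - α D_{d_ρ^{π_θ}}(π_θ || π_{θk}) / (1 - γ)`. -/
noncomputable def regValue [DecidableEq S] (M : MOMDP S A m) (R : S → A → ℝ) (α : ℝ)
    (θk θ : S × A → ℝ) : ℝ :=
  M.valueInit R (softmax θ) -
    α * (policyKL (M.stateVisitation (softmax θ)) (softmax θ) (softmax θk) / (1 - M.γ))

/-- The Fisher information matrix
`𝔼_{(s,a) ∼ d_ρ^{π_θ}} [∇_θ log π_θ(a|s) (∇_θ log π_θ(a|s))ᵀ]`. -/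
noncomputable def fisher [DecidableEq S] [DecidableEq A] (M : MOMDP S A m) (θ : S × A → ℝ) :
    Matrix (S × A) (S × A) ℝ :=
  ∑ s, ∑ a, M.visitation (softmax θ) s a •
    Matrix.vecMulVec (coordGrad (fun θ' => Real.log (softmax θ' s a)) θ)
      (coordGrad (fun θ' => Real.log (softmax θ' s a)) θ)

/-- One natural policy gradient step on the regularized value. -/
noncomputable def npgStep [DecidableEq S] [DecidableEq A] (M : MOMDP S A m) (R : S → A → ℝ)
    (α η : ℝ) (θk θ : S × A → ℝ) : S × A → ℝ :=
  θ + η • (moorePenrose (M.fisher θ) *ᵥ coordGrad (M.regValue R α θk) θ)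

/-- InnerLoop: `t` natural policy gradient steps started at the anchor `θk`. -/
noncomputable def innerLoop [DecidableEq S] [DecidableEq A] (M : MOMDP S A m) (R : S → A → ℝ)
    (α η : ℝ) (t : ℕ) (θk : S × A → ℝ) : S × A → ℝ :=
  (M.npgStep R α η θk)^[t] θk

/-- The reward in the ascent direction, `r̃(s,a) = ⟨∇F(V_{1:m}^{π_θ}(ρ)), r_{1:m}(s,a)⟩`. -/
noncomputable def ascentReward [DecidableEq S] (M : MOMDP S A m) (F : (Fin m → ℝ) → ℝ)
    (θ : S × A → ℝ) : S → A → ℝ :=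
  fun s a => ∑ i, coordGradWithin F M.valueBox (M.valueVec (softmax θ)) i * M.r i s a

/-- The parameters `θ_0, θ_1, …` of the policies `π_0, π_1, …` produced by ARNPG-IMD with initial
parameter `θ₀`, where macro step `k` uses `t k` inner iterations. -/
noncomputable def arnpgIMD [DecidableEq S] [DecidableEq A] (M : MOMDP S A m) (F : (Fin m → ℝ) → ℝ)
    (α η : ℝ) (t : ℕ → ℕ) (θ₀ : S × A → ℝ) : ℕ → S × A → ℝ
  | 0 => θ₀
  | k + 1 =>
      M.innerLoop (M.ascentReward F (M.arnpgIMD F α η t θ₀ k)) α η (t k) (M.arnpgIMD F α η t θ₀ k)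

end MOMDP

/-! The algorithm is approximate mirror ascent on `F` composed with the value vector, with the
policy KL divergence as Bregman distance; each mirror step is solved inexactly by natural policy
gradient.

Inner loop. The gradient of the regularized value is the Fisher matrix applied to the regularized
advantage divided by `1 - γ`, so the first Penrose equation identifies the natural gradient up to
directions that leave the policy unchanged at reachable states. With `η = (1 - γ) / α` one step is
then exactly soft policy iteration: the new policy is the Gibbs policy `π_k exp(Q / α)`, normalized
(`softmax_npgStep`). Soft policy iteration contracts towards the soft-optimal value at rate `γ`
(`exists_isValue_innerLoop`).

Mirror step. The performance difference identity and the Gibbs variational identity give an exact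
formula for the regularized value of every policy plus its divergence from the new policy
(`valueInit_eq_softMax`). Using it for a comparison policy and for the new policy yields the
three-point inequality, with an error of order `γ ^ t` (`innerLoop_mirror_step`).

Outer loop. Concavity bounds `F` at the comparison policy by its linearization, and smoothness
bounds `F` at the new policy from below up to `β ‖ΔV‖ ^ 2`. A Pinsker-type estimate gives `‖ΔV‖ ^ 2
≤ D / (1 - γ) ^ 4`, so the condition on `α` lets the regularizer absorb that term
(`macroStep_gap_le`). Divergences from successive iterates are all weighted by the visitation of the
same comparison policy, hence telescope from at most `log |A|`. The average gap is thus of order `β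
/ ((1 - γ) ^ 4 K)`; each macro step costs `O(log T / (1 - γ))` iterations, which accounts for the
remaining factor. -/

/-! ### Softmax policies -/

theorem softmax_pos {S A : Type*} [Fintype A] (θ : S × A → ℝ) (s : S) (a : A) :
    0 < softmax θ s a := by
  have : Nonempty A := ⟨a⟩
  unfold softmax
  positivity

theorem isPolicy_softmax {S A : Type*} [Fintype A] [Nonempty A] (θ : S × A → ℝ) :
    IsPolicy (softmax θ) := by
  refine fun s => ⟨fun a => (softmax_pos θ s a).le, ?_⟩
  have : 0 < ∑ a', Real.exp (θ (s, a')) := by positivity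
  simp only [softmax]
  rw [← Finset.sum_div, div_self this.ne']

theorem continuous_softmax {S A : Type*} [Fintype A] (s : S) (a : A) :
    Continuous fun θ : S × A → ℝ => softmax θ s a := by
  have : Nonempty A := ⟨a⟩
  unfold softmax
  refine Continuous.div (by fun_prop) (by fun_prop) fun θ => ?_
  positivity

/-! ### Visitation distributions and reachable states -/

namespace MOMDP

variable {S A : Type*} [Fintype S] [Fintype A] {m : ℕ}

/-- The expected value of `V` after taking action `a` in state `s`. -/
def next (M : MOMDP S A m) (V : S → ℝ) (s : S) (a : A) : ℝ :=
  ∑ s', M.P s a s' * V s'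

/-- The states that some policy reaches with positive probability. -/
inductive Reachable (M : MOMDP S A m) : S → Prop
  | init (s : S) : 0 < M.ρ s → M.Reachable s
  | step (s : S) (a : A) (s' : S) : M.Reachable s → 0 < M.P s a s' → M.Reachable s'

theorem one_sub_γ_pos (M : MOMDP S A m) : 0 < 1 - M.γ := sub_pos.2 M.γ_lt_one

/-- The comparison is needed only on a set `X` containing all possible successors. Later `X` is the
set of reachable states, since nothing is known about the iterates elsewhere. -/
theorem next_le (M : MOMDP S A m) {X : Set S} {s : S} {a : A}
    (hX : ∀ s', 0 < M.P s a s' → s' ∈ X) {V W : S → ℝ} {c : ℝ} (h : ∀ s ∈ X, V s ≤ W s + c) :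
    M.next V s a ≤ M.next W s a + c := by
  have h1 : ∑ s', M.P s a s' * c = c := by rw [← Finset.sum_mul, (M.P_mem s a).2, one_mul]
  unfold next
  rw [← h1, ← Finset.sum_add_distrib]
  refine Finset.sum_le_sum fun s' _ => ?_
  rcases ((M.P_mem s a).1 s').eq_or_lt with h0 | h0
  · simp [← h0]
  · nlinarith [h s' (hX s' h0)]

section

variable [DecidableEq S] (M : MOMDP S A m) {π : S → A → ℝ}

theorem stateProb_mem (hπ : IsPolicy π) (s₀ : S) (t : ℕ) :
    M.stateProb π s₀ t ∈ stdSimplex ℝ S := by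
  induction t with
  | zero => exact ⟨fun s => by simp only [stateProb]; split_ifs <;> norm_num, by simp [stateProb]⟩
  | succ t ih =>
    refine ⟨fun s => Finset.sum_nonneg fun s' _ => Finset.sum_nonneg fun a' _ =>
      mul_nonneg (mul_nonneg (ih.1 _) ((hπ _).1 _)) ((M.P_mem _ _).1 _), ?_⟩
    simp only [stateProb]
    rw [Finset.sum_comm, ← ih.2]
    refine Finset.sum_congr rfl fun s' _ => ?_
    rw [Finset.sum_comm]
    simp only [← Finset.mul_sum, (M.P_mem _ _).2, (hπ _).2, mul_one]

theorem abs_stateProb_le (hπ : IsPolicy π) (s₀ : S) (t : ℕ) (s : S) :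
    |M.stateProb π s₀ t s| ≤ 1 := by
  have h := M.stateProb_mem hπ s₀ t
  rw [abs_of_nonneg (h.1 s), ← h.2]
  exact Finset.single_le_sum (fun i _ => h.1 i) (Finset.mem_univ s)

theorem summable_stateProb (hπ : IsPolicy π) (s₀ s : S) :
    Summable fun t => M.γ ^ t * M.stateProb π s₀ t s := by
  refine Summable.of_norm_bounded (summable_geometric_of_lt_one M.γ_pos.le M.γ_lt_one) fun t => ?_
  rw [Real.norm_eq_abs, abs_mul, abs_of_nonneg (pow_nonneg M.γ_pos.le t)]
  exact mul_le_of_le_one_right (pow_nonneg M.γ_pos.le t) (M.abs_stateProb_le hπ s₀ t s)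

theorem visitation_eq (hπ : IsPolicy π) (s : S) (a : A) :
    M.visitation π s a = M.stateVisitation π s * π s a := by
  have h : ∀ a, M.visitation π s a =
      ((1 - M.γ) * ∑ s₀, M.ρ s₀ * ∑' t : ℕ, M.γ ^ t * M.stateProb π s₀ t s) * π s a := by
    intro a
    simp only [visitation, stateActionProb, ← mul_assoc, tsum_mul_right]
    simp only [mul_assoc, Finset.sum_mul]
  rw [stateVisitation]
  simp only [h, ← Finset.mul_sum, (hπ s).2, mul_one]

theorem stateVisitation_eq (hπ : IsPolicy π) (s : S) :
    M.stateVisitation π s =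
      (1 - M.γ) * ∑ s₀, M.ρ s₀ * ∑' t : ℕ, M.γ ^ t * M.stateProb π s₀ t s := by
  simp only [stateVisitation, visitation, stateActionProb, ← mul_assoc, tsum_mul_right]
  simp only [← Finset.mul_sum, ← Finset.sum_mul, (hπ s).2, mul_one]

theorem stateVisitation_nonneg (hπ : IsPolicy π) (s : S) : 0 ≤ M.stateVisitation π s := by
  rw [M.stateVisitation_eq hπ]
  refine mul_nonneg M.one_sub_γ_pos.le (Finset.sum_nonneg fun s₀ _ => mul_nonneg (M.ρ_mem.1 _)
    (tsum_nonneg fun t => mul_nonneg (pow_nonneg M.γ_pos.le t) ((M.stateProb_mem hπ s₀ t).1 s)))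

theorem tsum_stateProb (hπ : IsPolicy π) (s₀ s : S) :
    ∑' t : ℕ, M.γ ^ t * M.stateProb π s₀ t s = (if s = s₀ then 1 else 0) +
      M.γ * ∑ s', ∑ a', (∑' t : ℕ, M.γ ^ t * M.stateProb π s₀ t s') * π s' a' * M.P s' a' s := by
  rw [(M.summable_stateProb hπ s₀ s).tsum_eq_zero_add]
  congr 1
  · simp [stateProb]
  · simp only [← tsum_mul_right]
    have hs : ∀ s' a', Summable fun t =>
        M.γ ^ t * M.stateProb π s₀ t s' * π s' a' * M.P s' a' s := fun s' a' =>
      ((M.summable_stateProb hπ s₀ s').mul_right _).mul_right _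
    have h1 : ∀ s', ∑ a', ∑' t, M.γ ^ t * M.stateProb π s₀ t s' * π s' a' * M.P s' a' s =
        ∑' t, ∑ a', M.γ ^ t * M.stateProb π s₀ t s' * π s' a' * M.P s' a' s := fun s' =>
      (Summable.tsum_finsetSum fun a' _ => hs s' a').symm
    simp only [h1]
    rw [← Summable.tsum_finsetSum fun s' _ => summable_sum fun a' _ => hs s' a', ← tsum_mul_left]
    refine tsum_congr fun t => ?_
    simp only [stateProb, Finset.mul_sum]
    refine Finset.sum_congr rfl fun s' _ => Finset.sum_congr rfl fun a' _ => ?_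
    ring

theorem stateVisitation_flow (hπ : IsPolicy π) (s : S) :
    M.stateVisitation π s = (1 - M.γ) * M.ρ s +
      M.γ * ∑ s', ∑ a', M.stateVisitation π s' * π s' a' * M.P s' a' s := by
  simp only [M.stateVisitation_eq hπ]
  conv_lhs => simp only [M.tsum_stateProb hπ _ s]
  simp only [mul_add, Finset.sum_add_distrib, Finset.mul_sum, Finset.sum_mul]
  congr 1
  · simp
  · rw [Finset.sum_comm]
    refine Finset.sum_congr rfl fun s' _ => ?_
    rw [Finset.sum_comm]
    refine Finset.sum_congr rfl fun a' _ => Finset.sum_congr rfl fun s₀ _ => ?_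
    ring

/-- Discounted flow conservation, tested against a function of the state. -/
theorem sum_stateVisitation_mul (hπ : IsPolicy π) (V : S → ℝ) :
    ∑ s, M.stateVisitation π s * (V s - M.γ * ∑ a, π s a * M.next V s a) =
      (1 - M.γ) * ∑ s, M.ρ s * V s := by
  have h : ∑ s, M.stateVisitation π s * V s = (1 - M.γ) * ∑ s, M.ρ s * V s +
      M.γ * ∑ s, M.stateVisitation π s * ∑ a, π s a * M.next V s a := by
    conv_lhs => enter [2, s]; rw [M.stateVisitation_flow hπ s, add_mul]
    rw [Finset.sum_add_distrib]
    congr 1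
    · simp only [Finset.mul_sum, mul_assoc]
    · simp only [next, Finset.mul_sum, Finset.sum_mul]
      rw [Finset.sum_comm]
      refine Finset.sum_congr rfl fun s' _ => ?_
      rw [Finset.sum_comm]
      refine Finset.sum_congr rfl fun a' _ => Finset.sum_congr rfl fun s₀ _ => ?_
      ring
  simp only [mul_sub, Finset.sum_sub_distrib, h]
  rw [Finset.mul_sum, add_sub_assoc, add_eq_left, sub_eq_zero,
    Finset.mul_sum]
  exact Finset.sum_congr rfl fun s _ => mul_left_comm _ _ _

theorem sum_stateVisitation (hπ : IsPolicy π) : ∑ s, M.stateVisitation π s = 1 := by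
  have h := M.sum_stateVisitation_mul hπ 1
  simp only [next, Pi.one_apply, mul_one, (M.P_mem _ _).2, (hπ _).2, M.ρ_mem.2,
    ← Finset.sum_mul] at h
  exact mul_right_cancel₀ M.one_sub_γ_pos.ne' (by linarith)

theorem valueInit_eq (hπ : IsPolicy π) (R : S → A → ℝ) :
    M.valueInit R π = 1 / (1 - M.γ) * ∑ s, M.stateVisitation π s * ∑ a, π s a * R s a := by
  have h : ∀ s₀, M.value R π s₀ =
      ∑ s, (∑' t : ℕ, M.γ ^ t * M.stateProb π s₀ t s) * ∑ a, π s a * R s a := by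
    intro s₀
    simp only [← tsum_mul_right]
    rw [value, ← Summable.tsum_finsetSum fun s _ => (M.summable_stateProb hπ s₀ s).mul_right _]
    refine tsum_congr fun t => ?_
    simp only [stateActionProb, Finset.mul_sum]
    exact Finset.sum_congr rfl fun s _ => Finset.sum_congr rfl fun a _ => by ring
  simp only [valueInit, h, M.stateVisitation_eq hπ]
  have h1 := M.one_sub_γ_pos.ne'
  simp only [Finset.mul_sum, Finset.sum_mul]
  rw [Finset.sum_comm]
  refine Finset.sum_congr rfl fun s _ => ?_
  rw [Finset.sum_comm]
  refine Finset.sum_congr rfl fun a _ => Finset.sum_congr rfl fun s₀ _ => ?_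
  field_simp

/-- Together with `stateVisitation_eq_zero` this shows that all softmax policies have the same
visitation support, the reachable states. There the Fisher matrix determines the natural gradient up
to a shift in each state; elsewhere its rows vanish, but those states carry no weight. -/
theorem stateVisitation_pos (hπ : IsPolicy π) (h0 : ∀ s a, 0 < π s a) {s : S}
    (hs : M.Reachable s) : 0 < M.stateVisitation π s := by
  have hnn : ∀ s s' a', 0 ≤ M.stateVisitation π s' * π s' a' * M.P s' a' s := fun s s' a' =>
    mul_nonneg (mul_nonneg (M.stateVisitation_nonneg hπ _) (h0 _ _).le) ((M.P_mem _ _).1 _)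
  induction hs with
  | init s hs =>
    rw [M.stateVisitation_flow hπ]
    have h1 := mul_pos M.one_sub_γ_pos hs
    exact add_pos_of_pos_of_nonneg h1 (mul_nonneg M.γ_pos.le (Finset.sum_nonneg fun s' _ =>
      Finset.sum_nonneg fun a' _ => hnn s s' a'))
  | step s a s' _ hP ih =>
    rw [M.stateVisitation_flow hπ]
    refine add_pos_of_nonneg_of_pos (mul_nonneg M.one_sub_γ_pos.le (M.ρ_mem.1 _))
      (mul_pos M.γ_pos ?_)
    refine Finset.sum_pos' (fun x _ => Finset.sum_nonneg fun y _ => hnn _ _ _)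
      ⟨s, Finset.mem_univ _, Finset.sum_pos' (fun y _ => hnn _ _ _) ⟨a, Finset.mem_univ _, ?_⟩⟩
    exact mul_pos (mul_pos ih (h0 _ _)) hP

theorem reachable_of_stateProb_ne_zero {s₀ : S} (h0 : M.Reachable s₀) {t : ℕ}
    {s : S} (h : M.stateProb π s₀ t s ≠ 0) : M.Reachable s := by
  induction t generalizing s with
  | zero =>
    simp only [stateProb, ne_eq, ite_eq_right_iff, one_ne_zero, imp_false, not_not] at h
    exact h ▸ h0
  | succ t ih =>
    obtain ⟨s', -, h⟩ := Finset.exists_ne_zero_of_sum_ne_zero h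
    obtain ⟨a', -, h⟩ := Finset.exists_ne_zero_of_sum_ne_zero h
    exact Reachable.step s' a' s (ih fun h' => h (by simp [h']))
      (lt_of_le_of_ne ((M.P_mem _ _).1 _) fun h' => h (by simp [← h']))

theorem stateVisitation_eq_zero (hπ : IsPolicy π) {s : S}
    (hs : ¬ M.Reachable s) : M.stateVisitation π s = 0 := by
  rw [M.stateVisitation_eq hπ]
  refine mul_eq_zero_of_right _ (Finset.sum_eq_zero fun s₀ _ => ?_)
  rcases (M.ρ_mem.1 s₀).eq_or_lt with h | h
  · simp [← h]
  · have : ∀ t, M.stateProb π s₀ t s = 0 := fun t => by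
      by_contra h'
      exact hs (M.reachable_of_stateProb_ne_zero (.init _ h) h')
    simp [this]

/-- The geometric majorant is uniform in `θ`. Continuity is enough for the policy gradient because
of `HasFDerivAt.mul_of_eq_zero`. -/
theorem continuous_stateVisitation [Nonempty A] (s : S) :
    Continuous fun θ : S × A → ℝ => M.stateVisitation (softmax θ) s := by
  have hc : ∀ s₀ t s, Continuous fun θ : S × A → ℝ => M.stateProb (softmax θ) s₀ t s := by
    intro s₀ t
    induction t with
    | zero => intro s; simp only [stateProb]; exact continuous_const
    | succ t ih =>
      intro s
      simp only [stateProb]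
      exact continuous_finsetSum _ fun s' _ => continuous_finsetSum _ fun a' _ =>
        ((ih s').mul (continuous_softmax s' a')).mul continuous_const
  simp only [M.stateVisitation_eq (isPolicy_softmax _)]
  refine continuous_const.mul (continuous_finsetSum _ fun s₀ _ => continuous_const.mul ?_)
  refine continuous_tsum (fun t => continuous_const.mul (hc s₀ t s))
    (summable_geometric_of_lt_one M.γ_pos.le M.γ_lt_one) fun t θ => ?_
  rw [Real.norm_eq_abs, abs_mul, abs_of_nonneg (pow_nonneg M.γ_pos.le t)]
  exact mul_le_of_le_one_right (pow_nonneg M.γ_pos.le t)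
    (M.abs_stateProb_le (isPolicy_softmax θ) s₀ t s)

end

end MOMDP

/-! ### Fixed points and sup bounds for discounted operators -/

/-- Blackwell's criterion: using the hypothesis in both directions with `c = dist V W` makes `T` a
sup-norm contraction. -/
theorem exists_fixedPoint_of_contraction {S : Type*} [Fintype S] {γ : ℝ} (h0 : 0 ≤ γ) (h1 : γ < 1)
    (T : (S → ℝ) → S → ℝ)
    (hT : ∀ (V W : S → ℝ) (c : ℝ), (∀ s, V s ≤ W s + c) → ∀ s, T V s ≤ T W s + γ * c) :
    ∃ V, T V = V := by
  have hc : ContractingWith ⟨γ, h0⟩ T := by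
    refine ⟨by exact_mod_cast h1, LipschitzWith.of_dist_le_mul fun V W => ?_⟩
    refine (dist_pi_le_iff (mul_nonneg h0 dist_nonneg)).2 fun s => ?_
    have hVW : ∀ s, |V s - W s| ≤ dist V W := fun s => by
      rw [← Real.dist_eq]; exact dist_le_pi_dist V W s
    have e1 := hT V W (dist V W) (fun s => by linarith [(abs_le.1 (hVW s)).2]) s
    have e2 := hT W V (dist V W) (fun s => by linarith [(abs_le.1 (hVW s)).1]) s
    rw [Real.dist_eq, abs_le]
    change -(γ * dist V W) ≤ _ ∧ _ ≤ γ * dist V W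
    constructor <;> linarith
  exact ⟨_, hc.fixedPoint_isFixedPt⟩

/-- Taking `c` to be the maximum of `f` on the finite set `X` gives `c ≤ b + γ * c`. This replaces
iterating Bellman inequalities. -/
theorem le_of_forall_le_add_mul {S : Type*} [Finite S] {γ b : ℝ} (h1 : γ < 1) {X : Set S}
    {f : S → ℝ} (h : ∀ c, (∀ s ∈ X, f s ≤ c) → ∀ s ∈ X, f s ≤ b + γ * c) {s : S} (hs : s ∈ X) :
    f s ≤ b / (1 - γ) := by
  obtain ⟨x, hx, hmax⟩ := X.toFinite.exists_maximalFor f X ⟨s, hs⟩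
  have hm : ∀ y ∈ X, f y ≤ f x := fun y hy => by
    by_contra h'
    exact h' (hmax hy (not_le.1 h').le)
  have hle := h _ hm x hx
  refine (hm s hs).trans ?_
  rw [le_div_iff₀ (sub_pos.2 h1)]
  linarith

/-! ### KL divergence, log-partition function and Gibbs distributions -/

section

variable {A : Type*} [Fintype A]

/-- Pinsker's inequality with 4 in place of 2, by way of the Hellinger distance: `log x ≤ x - 1` at
`√(q / p)` bounds the squared Hellinger distance by the divergence, and Cauchy–Schwarz applied to `p
- q = (√p - √q)(√p + √q)` does the rest. -/
theorem kl_ge_sq_abs {p q : A → ℝ} (hp : p ∈ stdSimplex ℝ A) (hq : q ∈ stdSimplex ℝ A)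
    (hq0 : ∀ a, 0 < q a) : (∑ a, |p a - q a|) ^ 2 ≤ 4 * kl p q := by
  have h1 : ∑ a, (√(p a) - √(q a)) ^ 2 ≤ kl p q := by
    have : ∑ a, (√(p a) - √(q a)) ^ 2 = ∑ a, (2 * p a - 2 * (√(p a) * √(q a))) := by
      have e : ∀ a, (√(p a) - √(q a)) ^ 2 = p a + q a - 2 * (√(p a) * √(q a)) := fun a => by
        have e1 := Real.sq_sqrt (hp.1 a)
        have e2 := Real.sq_sqrt (hq0 a).le
        linear_combination e1 + e2
      simp only [e, Finset.sum_sub_distrib, Finset.sum_add_distrib, ← Finset.mul_sum, hp.2, hq.2]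
      norm_num
    rw [this, kl]
    refine Finset.sum_le_sum fun a _ => ?_
    rcases (hp.1 a).eq_or_lt with h | h
    · simp [← h]
    · have hs := Real.sqrt_pos.2 h
      have hs' := Real.sqrt_pos.2 (hq0 a)
      have e1 := Real.sq_sqrt h.le
      have e2 := Real.sq_sqrt (hq0 a).le
      have hlog : Real.log (p a / q a) = -(2 * Real.log (√(q a) / √(p a))) := by
        rw [Real.log_div h.ne' (hq0 a).ne', Real.log_div hs'.ne' hs.ne', Real.log_sqrt h.le,
          Real.log_sqrt (hq0 a).le]
        ring
      have hl := Real.log_le_sub_one_of_pos (div_pos hs' hs)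
      have e3 : p a * (√(q a) / √(p a)) = √(p a) * √(q a) := by
        field_simp
        rw [e1]
      rw [hlog]
      nlinarith
  have h2 : (∑ a, |p a - q a|) ^ 2 ≤
      (∑ a, (√(p a) - √(q a)) ^ 2) * ∑ a, (√(p a) + √(q a)) ^ 2 := by
    have := Finset.sum_mul_sq_le_sq_mul_sq Finset.univ (fun a => |√(p a) - √(q a)|)
      (fun a => √(p a) + √(q a))
    simp only [sq_abs] at this
    refine le_of_eq_of_le ?_ this
    congr 1
    refine Finset.sum_congr rfl fun a _ => ?_
    have e : p a - q a = (√(p a) - √(q a)) * (√(p a) + √(q a)) := by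
      have e1 := Real.sq_sqrt (hp.1 a)
      have e2 := Real.sq_sqrt (hq0 a).le
      linear_combination e2 - e1
    rw [e, abs_mul, abs_of_nonneg (a := √(p a) + √(q a)) (by positivity)]
  have h3 : ∑ a, (√(p a) + √(q a)) ^ 2 ≤ 4 := by
    have : ∀ a, (√(p a) + √(q a)) ^ 2 ≤ 2 * p a + 2 * q a := fun a => by
      have e1 := Real.sq_sqrt (hp.1 a)
      have e2 := Real.sq_sqrt (hq0 a).le
      nlinarith [sq_nonneg (√(p a) - √(q a))]
    refine (Finset.sum_le_sum fun a _ => this a).trans ?_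
    rw [Finset.sum_add_distrib, ← Finset.mul_sum, ← Finset.mul_sum, hp.2, hq.2]
    norm_num
  have h4 : 0 ≤ ∑ a, (√(p a) - √(q a)) ^ 2 := Finset.sum_nonneg fun a _ => sq_nonneg _
  nlinarith

theorem kl_nonneg {p q : A → ℝ} (hp : p ∈ stdSimplex ℝ A) (hq : q ∈ stdSimplex ℝ A)
    (hq0 : ∀ a, 0 < q a) : 0 ≤ kl p q := by
  nlinarith [kl_ge_sq_abs hp hq hq0, sq_nonneg (∑ a, |p a - q a|)]

theorem kl_uniform_le {p q : A → ℝ} (hp : p ∈ stdSimplex ℝ A) (hA : 0 < Fintype.card A)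
    (hq : ∀ a, q a = 1 / (Fintype.card A : ℝ)) : kl p q ≤ Real.log (Fintype.card A) := by
  have hA' : (0 : ℝ) < Fintype.card A := by exact_mod_cast hA
  calc kl p q ≤ ∑ a, p a * Real.log (Fintype.card A) := by
        refine Finset.sum_le_sum fun a _ => ?_
        rcases (hp.1 a).eq_or_lt with h | h
        · simp [← h]
        · refine mul_le_mul_of_nonneg_left (Real.log_le_log (div_pos h ?_) ?_) h.le
          · rw [hq]; positivity
          · have h1 : p a ≤ 1 := hp.2 ▸ Finset.single_le_sum (fun i _ => hp.1 i) (Finset.mem_univ a)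
            rw [hq, div_div_eq_mul_div, div_one]
            exact mul_le_of_le_one_left hA'.le h1
    _ = Real.log (Fintype.card A) := by rw [← Finset.sum_mul, hp.2, one_mul]

/-- The log-partition function `α log ∑ a, q a exp (Q a / α)`. -/
noncomputable def softMax (α : ℝ) (q Q : A → ℝ) : ℝ :=
  α * Real.log (∑ a, q a * Real.exp (Q a / α))

/-- The Gibbs distribution with density proportional to `exp (Q a / α)` relative to `q`. -/
noncomputable def gibbs (α : ℝ) (q Q : A → ℝ) (a : A) : ℝ :=
  q a * Real.exp ((Q a - softMax α q Q) / α)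

theorem softMax_le [Nonempty A] {α : ℝ} (hα : 0 < α) {q : A → ℝ} (hq : ∀ a, 0 < q a)
    {Q Q' : A → ℝ} {c : ℝ} (h : ∀ a, Q a ≤ Q' a + c) : softMax α q Q ≤ softMax α q Q' + c := by
  have hpos : ∀ Q : A → ℝ, 0 < ∑ a, q a * Real.exp (Q a / α) := fun Q =>
    Finset.sum_pos (fun a _ => mul_pos (hq a) (Real.exp_pos _)) Finset.univ_nonempty
  have h1 : ∑ a, q a * Real.exp (Q a / α) ≤ (∑ a, q a * Real.exp (Q' a / α)) * Real.exp (c / α) := by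
    rw [Finset.sum_mul]
    refine Finset.sum_le_sum fun a _ => ?_
    rw [mul_assoc, ← Real.exp_add, ← add_div]
    have := h a
    have := hq a
    gcongr
  have h2 := Real.log_le_log (hpos Q) h1
  rw [Real.log_mul (hpos Q').ne' (Real.exp_pos _).ne', Real.log_exp] at h2
  have h3 := mul_le_mul_of_nonneg_left h2 hα.le
  rw [mul_add, mul_div_cancel₀ _ hα.ne'] at h3
  exact h3

theorem softMax_const {α : ℝ} (hα : 0 < α) {q : A → ℝ} (hq : q ∈ stdSimplex ℝ A) (c : ℝ) :
    softMax α q (fun _ => c) = c := by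
  rw [softMax, ← Finset.sum_mul, hq.2, one_mul, Real.log_exp, mul_div_cancel₀ _ hα.ne']

theorem gibbs_eq_div [Nonempty A] {α : ℝ} (hα : 0 < α) {q : A → ℝ} (hq : ∀ a, 0 < q a)
    (Q : A → ℝ) (a : A) :
    gibbs α q Q a = q a * Real.exp (Q a / α) / ∑ b, q b * Real.exp (Q b / α) := by
  have hpos : 0 < ∑ a, q a * Real.exp (Q a / α) :=
    Finset.sum_pos (fun a _ => mul_pos (hq a) (Real.exp_pos _)) Finset.univ_nonempty
  rw [gibbs, softMax, sub_div, mul_div_cancel_left₀ _ hα.ne', Real.exp_sub, Real.exp_log hpos,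
    mul_div_assoc]

/-- The Gibbs variational identity. -/
theorem sum_mul_sub_log_eq {α : ℝ} (hα : 0 < α) {p q : A → ℝ}
    (hp : p ∈ stdSimplex ℝ A) (hq : ∀ a, 0 < q a) (Q : A → ℝ) :
    ∑ a, p a * (Q a - α * Real.log (p a / q a)) =
      softMax α q Q - α * kl p (gibbs α q Q) := by
  have h1 : ∀ a, p a * (Q a - α * Real.log (p a / q a)) =
      p a * softMax α q Q - α * (p a * Real.log (p a / gibbs α q Q a)) := by
    intro a
    rcases (hp.1 a).eq_or_lt with h | h
    · simp [← h]
    · have hg : 0 < Real.exp ((Q a - softMax α q Q) / α) := Real.exp_pos _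
      rw [gibbs, Real.log_div h.ne' (hq a).ne', Real.log_div h.ne' (mul_pos (hq a) hg).ne',
        Real.log_mul (hq a).ne' hg.ne', Real.log_exp]
      field_simp
      ring
  simp only [h1, Finset.sum_sub_distrib, ← Finset.sum_mul, ← Finset.mul_sum, hp.2, kl, one_mul]

end

/-! ### Bellman equations and the performance difference identity -/

namespace MOMDP

variable {S A : Type*} [Fintype S] [Fintype A] {m : ℕ} (M : MOMDP S A m)

/-- The action value function with continuation values `V`. -/
def qValue (R : S → A → ℝ) (V : S → ℝ) (s : S) (a : A) : ℝ :=
  R s a + M.γ * M.next V s a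

/-- `V` solves the Bellman equation of the policy `π` for the reward `R`. -/
def IsValue (R π : S → A → ℝ) (V : S → ℝ) : Prop :=
  ∀ s, V s = ∑ a, π s a * M.qValue R V s a

/-- The reward `R` minus the cost of deviating from the policy `π₀`. -/
noncomputable def regReward (R : S → A → ℝ) (α : ℝ) (π₀ π : S → A → ℝ) (s : S) (a : A) : ℝ :=
  R s a - α * Real.log (π s a / π₀ s a)

theorem qValue_le {X : Set S} {s : S} {a : A} (hX : ∀ s', 0 < M.P s a s' → s' ∈ X)
    {V W : S → ℝ} {c : ℝ} (h : ∀ s ∈ X, V s ≤ W s + c) (R : S → A → ℝ) :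
    M.qValue R V s a ≤ M.qValue R W s a + M.γ * c := by
  have := mul_le_mul_of_nonneg_left (M.next_le hX h) M.γ_pos.le
  simp only [qValue]
  linarith

theorem sum_mul_le_sum_mul_add {p x y : A → ℝ} {c : ℝ} (hp : p ∈ stdSimplex ℝ A)
    (h : ∀ a, x a ≤ y a + c) : ∑ a, p a * x a ≤ ∑ a, p a * y a + c := by
  have h1 : ∑ a, p a * (y a + c) = ∑ a, p a * y a + c := by
    simp only [mul_add, Finset.sum_add_distrib, ← Finset.sum_mul, hp.2, one_mul]
  exact (Finset.sum_le_sum fun a _ => mul_le_mul_of_nonneg_left (h a) (hp.1 a)).trans h1.le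

/-- State values are obtained from the Bellman equation rather than from the discounted series;
`valueInit_sub` links the two. -/
theorem exists_isValue {π : S → A → ℝ} (hπ : IsPolicy π) (R : S → A → ℝ) :
    ∃ V, M.IsValue R π V := by
  obtain ⟨V, hV⟩ := exists_fixedPoint_of_contraction M.γ_pos.le M.γ_lt_one
    (fun V s => ∑ a, π s a * M.qValue R V s a) fun V W c h s =>
      sum_mul_le_sum_mul_add (hπ s) fun a => M.qValue_le (X := Set.univ) (by simp) (by simpa) R
  exact ⟨V, fun s => (congrFun hV s).symm⟩

/-- The fixed point of the soft Bellman operator is the yardstick against which the inner iterates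
are measured. -/
theorem exists_softValue [Nonempty A] {α : ℝ} (hα : 0 < α) {π₀ : S → A → ℝ}
    (hπ₀ : ∀ s a, 0 < π₀ s a) (R : S → A → ℝ) :
    ∃ V : S → ℝ, ∀ s, V s = softMax α (π₀ s) (M.qValue R V s) := by
  obtain ⟨V, hV⟩ := exists_fixedPoint_of_contraction M.γ_pos.le M.γ_lt_one
    (fun V s => softMax α (π₀ s) (M.qValue R V s)) fun V W c h s =>
      softMax_le hα (hπ₀ s) fun a => M.qValue_le (X := Set.univ) (by simp) (by simpa) R
  exact ⟨V, fun s => (congrFun hV s).symm⟩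

theorem IsValue.le {M : MOMDP S A m} {R π : S → A → ℝ} {V : S → ℝ} (hV : M.IsValue R π V)
    (hπ : IsPolicy π) {b : ℝ} (hR : ∀ s a, R s a ≤ b) (s : S) : V s ≤ b / (1 - M.γ) := by
  refine le_of_forall_le_add_mul (γ := M.γ) M.γ_lt_one (X := Set.univ) (fun c hc s _ => ?_)
    (Set.mem_univ s)
  rw [hV s]
  refine (sum_mul_le_sum_mul_add (y := 0) (c := b + M.γ * c) (hπ s) fun a => ?_).trans_eq (by simp)
  have h := M.qValue_le (X := Set.univ) (s := s) (a := a) (by simp) (W := 0) (by simpa using hc) R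
  have := hR s a
  simp only [qValue, next, Pi.zero_apply, mul_zero, Finset.sum_const_zero, zero_add] at h ⊢
  linarith

theorem IsValue.ge {M : MOMDP S A m} {R π : S → A → ℝ} {V : S → ℝ} (hV : M.IsValue R π V)
    (hπ : IsPolicy π) {b : ℝ} (hR : ∀ s a, b ≤ R s a) (s : S) : b / (1 - M.γ) ≤ V s := by
  have h : M.IsValue (-R) π (-V) := fun s => by
    simp only [Pi.neg_apply, hV s, qValue, next, mul_neg, Finset.sum_neg_distrib, ← neg_add]
  have := h.le hπ (b := -b) (fun s a => neg_le_neg (hR s a)) s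
  rw [neg_div, Pi.neg_apply] at this
  linarith

theorem softValue_le [Nonempty A] {α : ℝ} (hα : 0 < α) {π₀ : S → A → ℝ}
    (hπ₀ : ∀ s a, 0 < π₀ s a) (hπ₀' : IsPolicy π₀) {R : S → A → ℝ} {V : S → ℝ}
    (hV : ∀ s, V s = softMax α (π₀ s) (M.qValue R V s)) {b : ℝ} (hR : ∀ s a, R s a ≤ b) (s : S) :
    V s ≤ b / (1 - M.γ) := by
  refine le_of_forall_le_add_mul (γ := M.γ) M.γ_lt_one (X := Set.univ) (fun c hc s _ => ?_)
    (Set.mem_univ s)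
  rw [hV s]
  refine (softMax_le (Q' := fun _ => 0) hα (hπ₀ s) fun a => ?_).trans_eq
    (by rw [softMax_const hα (hπ₀' s), zero_add])
  have h := M.qValue_le (X := Set.univ) (s := s) (a := a) (by simp) (W := 0) (by simpa using hc) R
  have := hR s a
  simp only [qValue, next, Pi.zero_apply, mul_zero, Finset.sum_const_zero, zero_add] at h ⊢
  linarith

section

variable [DecidableEq S]

/-- Performance difference identity, a rewriting of flow conservation. It holds for arbitrary `V`;
when `V` solves the Bellman equation of another policy, the bracket is the expected advantage over
that policy. -/
theorem valueInit_sub {π : S → A → ℝ} (hπ : IsPolicy π) (R : S → A → ℝ) (V : S → ℝ) :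
    M.valueInit R π - ∑ s, M.ρ s * V s = 1 / (1 - M.γ) *
      ∑ s, M.stateVisitation π s * (∑ a, π s a * M.qValue R V s a - V s) := by
  have h := M.sum_stateVisitation_mul hπ V
  have h0 := M.one_sub_γ_pos.ne'
  have h1 : ∑ s, M.ρ s * V s = 1 / (1 - M.γ) *
      ∑ s, M.stateVisitation π s * (V s - M.γ * ∑ a, π s a * M.next V s a) := by
    rw [h]; field_simp
  rw [M.valueInit_eq hπ, h1, ← mul_sub, ← Finset.sum_sub_distrib]
  congr 1
  refine Finset.sum_congr rfl fun s _ => ?_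
  simp only [qValue, mul_add, Finset.sum_add_distrib, mul_left_comm _ M.γ, ← Finset.mul_sum]
  ring

theorem valueInit_regReward {π : S → A → ℝ} (hπ : IsPolicy π) (R : S → A → ℝ) (α : ℝ)
    (π₀ : S → A → ℝ) : M.valueInit (regReward R α π₀ π) π =
      M.valueInit R π - α * (policyKL (M.stateVisitation π) π π₀ / (1 - M.γ)) := by
  rw [M.valueInit_eq hπ, M.valueInit_eq hπ, policyKL, mul_div_assoc',
    div_eq_inv_mul (α * _), one_div, ← mul_sub, Finset.mul_sum _ _ α, ← Finset.sum_sub_distrib]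
  congr 1
  refine Finset.sum_congr rfl fun s _ => ?_
  simp only [regReward, kl, mul_sub, Finset.sum_sub_distrib, Finset.mul_sum]
  congr 1
  exact Finset.sum_congr rfl fun a _ => by ring

end

end MOMDP

/-! ### Derivatives of softmax policies -/

/-- Since `g` is `O(y - x)` and `f y - f x` is `o(1)`, the factor `f` may be frozen at `x`. In the
policy gradient `f` is the visitation distribution, which therefore never has to be differentiated.
-/
theorem HasFDerivAt.mul_of_eq_zero {E : Type*} [NormedAddCommGroup E] [NormedSpace ℝ E]
    {f g : E → ℝ} {g' : E →L[ℝ] ℝ} {x : E} (hf : ContinuousAt f x) (hg : HasFDerivAt g g' x)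
    (h0 : g x = 0) : HasFDerivAt (fun y => f y * g y) (f x • g') x := by
  have h1 : HasFDerivAt (fun y => (f y - f x) * g y) (0 : E →L[ℝ] ℝ) x := by
    refine .of_isLittleO ?_
    have e1 : (fun y => f y - f x) =o[nhds x] fun _ => (1 : ℝ) := by
      rw [Asymptotics.isLittleO_one_iff]
      simpa using hf.tendsto.sub_const (f x)
    have e2 : g =O[nhds x] fun y => y - x := by
      simpa [h0] using hg.isBigO_sub
    simpa [h0] using e1.mul_isBigO e2.norm_right
  have h2 := (hg.const_mul (f x)).add h1
  rw [add_zero] at h2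
  exact h2.congr_of_eventuallyEq (.of_forall fun y => by simp only [Pi.add_apply]; ring)

section

variable {S A : Type*} [Fintype A]

/-- The derivative of `log π_θ(a|s)` with respect to `θ`. -/
noncomputable def score (θ : S × A → ℝ) (s : S) (a : A) : (S × A → ℝ) →L[ℝ] ℝ :=
  .proj (s, a) - ∑ b, softmax θ s b • .proj (s, b)

theorem score_apply (θ x : S × A → ℝ) (s : S) (a : A) :
    score θ s a x = x (s, a) - ∑ b, softmax θ s b * x (s, b) := by
  simp [score]

theorem log_softmax (θ : S × A → ℝ) (s : S) (a : A) :
    Real.log (softmax θ s a) = θ (s, a) - Real.log (∑ b, Real.exp (θ (s, b))) := by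
  have : Nonempty A := ⟨a⟩
  rw [softmax, Real.log_div (Real.exp_pos _).ne' (by positivity), Real.log_exp]

theorem softmax_add_apply (θ w : S × A → ℝ) (s : S) {x : A → ℝ} {c : ℝ}
    (hw : ∀ b, w (s, b) = x b + c) (a : A) :
    softmax (θ + w) s a = softmax θ s a * Real.exp (x a) / ∑ b, softmax θ s b * Real.exp (x b) := by
  have : Nonempty A := ⟨a⟩
  have h : ∀ b, Real.exp ((θ + w) (s, b)) =
      softmax θ s b * Real.exp (x b) * ((∑ b, Real.exp (θ (s, b))) * Real.exp c) := by
    intro b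
    have : 0 < ∑ b, Real.exp (θ (s, b)) := by positivity
    rw [Pi.add_apply, hw, Real.exp_add, Real.exp_add, softmax]
    field_simp
  rw [softmax]
  simp only [h, ← Finset.sum_mul]
  have : 0 < ∑ b, Real.exp (θ (s, b)) := by positivity
  exact mul_div_mul_right _ _ (by positivity)

theorem score_single [DecidableEq S] [DecidableEq A] (θ : S × A → ℝ) (s s' : S) (a b : A) :
    score θ s a (Pi.single (s', b) 1) =
      if s = s' then (if a = b then 1 else 0) - softmax θ s b else 0 := by
  rw [score_apply]
  by_cases h : s = s'
  · subst h
    simp [Pi.single_apply]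
  · simp [h]

variable [Fintype S]

theorem hasFDerivAt_log_softmax (θ : S × A → ℝ) (s : S) (a : A) :
    HasFDerivAt (fun θ' => Real.log (softmax θ' s a)) (score θ s a) θ := by
  have : Nonempty A := ⟨a⟩
  have hpos : 0 < ∑ b, Real.exp (θ (s, b)) := by positivity
  have h1 : HasFDerivAt (fun θ' : S × A → ℝ => ∑ b, Real.exp (θ' (s, b)))
      (∑ b, Real.exp (θ (s, b)) • ContinuousLinearMap.proj (R := ℝ) (s, b)) θ :=
    HasFDerivAt.fun_sum fun b _ => (hasFDerivAt_apply (𝕜 := ℝ) (s, b) θ).exp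
  have h2 := (hasFDerivAt_apply (𝕜 := ℝ) (s, a) θ).sub (h1.log hpos.ne')
  refine (h2.congr_of_eventuallyEq (.of_forall fun θ' => log_softmax θ' s a)).congr_fderiv ?_
  rw [score, Finset.smul_sum]
  congr 1
  refine Finset.sum_congr rfl fun b _ => ?_
  rw [smul_smul, softmax, div_eq_inv_mul]

theorem hasFDerivAt_softmax (θ : S × A → ℝ) (s : S) (a : A) :
    HasFDerivAt (fun θ' => softmax θ' s a) (softmax θ s a • score θ s a) θ := by
  have h := (hasFDerivAt_log_softmax θ s a).exp
  simpa only [Real.exp_log (softmax_pos _ s a)] using h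

end

/-! ### Natural policy gradient as soft policy iteration -/

namespace MOMDP

variable {S A : Type*} [Fintype S] [Fintype A] [DecidableEq S] [DecidableEq A] {m : ℕ}
  (M : MOMDP S A m)

/-- The policy gradient formula for the regularized value. -/
theorem coordGrad_regValue [Nonempty A] {R : S → A → ℝ} {α : ℝ} {θ₀ θ : S × A → ℝ} {V : S → ℝ}
    (hV : M.IsValue (regReward R α (softmax θ₀) (softmax θ)) (softmax θ) V) (s : S) (b : A) :
    coordGrad (M.regValue R α θ₀) θ (s, b) = 1 / (1 - M.γ) * (M.stateVisitation (softmax θ) s *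
      (softmax θ s b *
        (M.qValue (regReward R α (softmax θ₀) (softmax θ)) V s b - V s))) := by
  set X := M.qValue (regReward R α (softmax θ₀) (softmax θ)) V with hX
  -- `V` is frozen at the value of the current `θ` while the policy varies, so the differentiated
  -- function vanishes at `θ` by the Bellman equation.
  have hg : ∀ s, HasFDerivAt
      (fun θ' => ∑ a, softmax θ' s a *
        M.qValue (regReward R α (softmax θ₀) (softmax θ')) V s a - V s)
      (∑ a, (softmax θ s a * (X s a - α)) • score θ s a) θ := by
    intro s
    refine (HasFDerivAt.fun_sum fun a _ => ?_).sub_const _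
    have hq : HasFDerivAt (fun θ' => M.qValue (regReward R α (softmax θ₀) (softmax θ')) V s a)
        (-(α • score θ s a)) θ := by
      refine (((hasFDerivAt_log_softmax θ s a).const_mul α).const_sub
        (R s a + α * Real.log (softmax θ₀ s a) + M.γ * M.next V s a)).congr_of_eventuallyEq
        (.of_forall fun θ' => ?_)
      simp only [qValue, regReward]
      rw [Real.log_div (softmax_pos _ _ _).ne' (softmax_pos _ _ _).ne']
      ring
    refine ((hasFDerivAt_softmax θ s a).mul hq).congr_fderiv ?_
    ext x
    simp only [add_apply, smul_apply,
      neg_apply, smul_eq_mul, ← hX]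
    ring
  have hd := HasFDerivAt.fun_sum (u := Finset.univ) fun s _ =>
    HasFDerivAt.mul_of_eq_zero (M.continuous_stateVisitation s).continuousAt (hg s)
      (sub_eq_zero.2 (hV s).symm)
  have hr := (hd.const_mul (1 / (1 - M.γ))).const_add (∑ s, M.ρ s * V s)
  have hr' : HasFDerivAt (M.regValue R α θ₀) _ θ :=
    hr.congr_of_eventuallyEq (.of_forall fun θ' => by
      beta_reduce
      rw [regValue, ← M.valueInit_regReward (isPolicy_softmax θ'),
        ← M.valueInit_sub (isPolicy_softmax θ')]
      ring)
  rw [coordGrad, hr'.fderiv]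
  -- The contribution `-α` from differentiating the logarithm is constant in the action and cancels
  -- against the centring of the score.
  have hsum : ∑ a, softmax θ s a * (X s a - α) = V s - α := by
    rw [hV s]
    simp only [mul_sub, Finset.sum_sub_distrib, ← Finset.sum_mul, (isPolicy_softmax θ s).2, one_mul,
      hX]
  simp only [smul_apply, sum_apply, score_single,
    smul_eq_mul, mul_ite, mul_zero]
  simp only [Finset.sum_ite_irrel, Finset.sum_const_zero, mul_ite, mul_zero, Finset.sum_ite_eq',
    Finset.mem_univ, if_true, mul_sub (_ * _), Finset.sum_sub_distrib, mul_one,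
    ← Finset.sum_mul, hsum]
  ring

/-- The matrix is block diagonal over states. The part `-softmax θ s b` of the score drops out
because the score paired with `x` has mean zero under the policy. -/
theorem fisher_mulVec [Nonempty A] (θ x : S × A → ℝ) (s : S) (b : A) :
    (M.fisher θ *ᵥ x) (s, b) =
      M.stateVisitation (softmax θ) s * (softmax θ s b * score θ s b x) := by
  have hu : ∀ s a, (coordGrad (fun θ' => Real.log (softmax θ' s a)) θ) ⬝ᵥ x = score θ s a x := by
    intro s a
    rw [← ContinuousLinearMap.coe_coe (score θ s a), LinearMap.pi_apply_eq_sum_univ, dotProduct]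
    refine Finset.sum_congr rfl fun i _ => ?_
    have hi : Pi.single i 1 = fun j => if i = j then (1 : ℝ) else 0 := by
      ext j
      simp [Pi.single_apply, eq_comm]
    rw [coordGrad, (hasFDerivAt_log_softmax θ s a).fderiv, smul_eq_mul, mul_comm, hi]
    rfl
  have h0 : ∑ a, softmax θ s a * score θ s a x = 0 := by
    simp only [score_apply, mul_sub, Finset.sum_sub_distrib, ← Finset.sum_mul,
      (isPolicy_softmax θ s).2, one_mul, sub_self]
  rw [fisher, Matrix.sum_mulVec, Finset.sum_apply]
  simp only [Matrix.sum_mulVec, Finset.sum_apply, Matrix.smul_mulVec, Matrix.vecMulVec_mulVec, hu,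
    Pi.smul_apply, smul_eq_mul, MulOpposite.smul_eq_mul_unop, MulOpposite.unop_op,
    M.visitation_eq (isPolicy_softmax θ)]
  simp only [coordGrad, (hasFDerivAt_log_softmax θ _ _).fderiv, score_single]
  rw [Finset.sum_eq_single s (fun s' _ h => by simp [h]) (by simp)]
  have h1 : ∀ a, M.stateVisitation (softmax θ) s * softmax θ s a *
      ((if s = s then (if a = b then 1 else 0) - softmax θ s b else 0) * score θ s a x) =
      (if a = b then M.stateVisitation (softmax θ) s * (softmax θ s a * score θ s a x) else 0) -
        M.stateVisitation (softmax θ) s * softmax θ s b * (softmax θ s a * score θ s a x) := by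
    intro a
    rw [if_pos rfl]
    split_ifs <;> ring
  rw [Finset.sum_congr rfl fun a _ => h1 a]
  simp only [ Finset.sum_sub_distrib, ← Finset.mul_sum, h0, mul_zero, sub_zero,
    Finset.sum_ite_eq', Finset.mem_univ, if_true]

theorem isMoorePenrose_moorePenrose {n : Type*} [Fintype n] (B : Matrix n n ℝ) :
    IsMoorePenrose B (moorePenrose B) :=
  Classical.choose_spec (exists_isMoorePenrose B)

/-- On reachable states the natural gradient is the advantage, up to a shift in each state. -/
theorem score_naturalGradient [Nonempty A] {R : S → A → ℝ} {α : ℝ} {θ₀ θ : S × A → ℝ} {V : S → ℝ}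
    (hV : M.IsValue (regReward R α (softmax θ₀) (softmax θ)) (softmax θ) V) {s : S}
    (hs : M.Reachable s) (b : A) :
    score θ s b (moorePenrose (M.fisher θ) *ᵥ coordGrad (M.regValue R α θ₀) θ) =
      1 / (1 - M.γ) * (M.qValue (regReward R α (softmax θ₀) (softmax θ)) V s b - V s) := by
  -- The advantage has mean zero under the policy, so the score returns its coordinates unchanged,
  -- and the Fisher matrix maps it to the gradient.
  set x : S × A → ℝ := fun i => 1 / (1 - M.γ) *
    (M.qValue (regReward R α (softmax θ₀) (softmax θ)) V i.1 i.2 - V i.1) with hx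
  have hsx : ∀ s b, score θ s b x = x (s, b) := by
    intro s b
    rw [score_apply, sub_eq_self]
    simp only [hx, mul_left_comm _ (1 / (1 - M.γ)), ← Finset.mul_sum, mul_sub,
      Finset.sum_sub_distrib, ← Finset.sum_mul, (isPolicy_softmax θ s).2, one_mul, ← hV s, sub_self]
  have hgrad : coordGrad (M.regValue R α θ₀) θ = M.fisher θ *ᵥ x := by
    ext ⟨s, b⟩
    rw [M.coordGrad_regValue hV, M.fisher_mulVec, hsx, hx]
    ring
  have h := congrFun (congrArg (· *ᵥ x)
    (isMoorePenrose_moorePenrose (M.fisher θ)).mul_mul_left) (s, b)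
  simp only [← Matrix.mulVec_mulVec] at h
  rw [M.fisher_mulVec, M.fisher_mulVec, ← hgrad, hsx] at h
  exact mul_left_cancel₀ (softmax_pos θ s b).ne' (mul_left_cancel₀
    (M.stateVisitation_pos (isPolicy_softmax θ) (softmax_pos θ) hs).ne' h)

/-- On reachable states a natural policy gradient step is a step of soft policy iteration. -/
theorem softmax_npgStep [Nonempty A] {R : S → A → ℝ} {α : ℝ} (hα : 0 < α) {θ₀ θ : S × A → ℝ}
    {V : S → ℝ} (hV : M.IsValue (regReward R α (softmax θ₀) (softmax θ)) (softmax θ) V) {s : S}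
    (hs : M.Reachable s) (a : A) :
    softmax (M.npgStep R α ((1 - M.γ) / α) θ₀ θ) s a =
      gibbs α (softmax θ₀ s) (M.qValue R V s) a := by
  set w := moorePenrose (M.fisher θ) *ᵥ coordGrad (M.regValue R α θ₀) θ with hw
  have h0 := M.one_sub_γ_pos.ne'
  -- With this step size the increment of the logits contains `-log (π_θ / π_{θ₀})`, which erases
  -- the current policy and leaves only the anchor; the state-dependent constant disappears on
  -- normalization.
  have h1 : ∀ b, (((1 - M.γ) / α) • w) (s, b) =
      (M.qValue R V s b / α - Real.log (softmax θ s b / softmax θ₀ s b)) +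
      ((1 - M.γ) / α * (∑ b, softmax θ s b * w (s, b)) - V s / α) := by
    intro b
    have h := M.score_naturalGradient hV hs b
    rw [← hw, score_apply, sub_eq_iff_eq_add] at h
    rw [Pi.smul_apply, smul_eq_mul, h]
    simp only [qValue, regReward]
    field_simp
    ring
  have h2 : ∀ b, softmax θ s b *
      Real.exp (M.qValue R V s b / α - Real.log (softmax θ s b / softmax θ₀ s b)) =
      softmax θ₀ s b * Real.exp (M.qValue R V s b / α) := by
    intro b
    have e1 := softmax_pos θ s b
    have e2 := softmax_pos θ₀ s b
    rw [Real.exp_sub, Real.exp_log (div_pos e1 e2)]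
    field_simp
  rw [npgStep, ← hw, softmax_add_apply θ _ s h1, gibbs_eq_div hα (softmax_pos θ₀ s)]
  simp only [h2]

end MOMDP

/-! ### Convergence of soft policy iteration and the mirror step -/

theorem gibbs_pos {A : Type*} [Fintype A] {α : ℝ} {q : A → ℝ} (hq : ∀ a, 0 < q a) (Q : A → ℝ)
    (a : A) : 0 < gibbs α q Q a :=
  mul_pos (hq a) (Real.exp_pos _)

theorem gibbs_mem_stdSimplex {A : Type*} [Fintype A] [Nonempty A] {α : ℝ} (hα : 0 < α) {q : A → ℝ}
    (hq : ∀ a, 0 < q a) (Q : A → ℝ) : gibbs α q Q ∈ stdSimplex ℝ A := by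
  refine ⟨fun a => (gibbs_pos hq Q a).le, ?_⟩
  have hpos : 0 < ∑ a, q a * Real.exp (Q a / α) :=
    Finset.sum_pos (fun a _ => mul_pos (hq a) (Real.exp_pos _)) Finset.univ_nonempty
  simp only [gibbs_eq_div hα hq, ← Finset.sum_div]
  exact div_self hpos.ne'

theorem kl_self {A : Type*} [Fintype A] {p : A → ℝ} (hp : ∀ a, 0 < p a) : kl p p = 0 :=
  Finset.sum_eq_zero fun a _ => by rw [div_self (hp a).ne', Real.log_one, mul_zero]

namespace MOMDP

variable {S A : Type*} [Fintype S] [Fintype A] {m : ℕ} (M : MOMDP S A m)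

/-- By the Gibbs variational identity, the regularized Bellman operator of `π` falls short of the
soft Bellman operator by exactly a KL term, which vanishes at the Gibbs policy. -/
theorem sum_mul_qValue_regReward {α : ℝ} (hα : 0 < α) {π π₀ : S → A → ℝ} (hπ : IsPolicy π)
    (hπ₀ : ∀ s a, 0 < π₀ s a) (R : S → A → ℝ) (V : S → ℝ) (s : S) :
    ∑ a, π s a * M.qValue (regReward R α π₀ π) V s a =
      softMax α (π₀ s) (M.qValue R V s) - α * kl (π s) (gibbs α (π₀ s) (M.qValue R V s)) := by
  rw [← sum_mul_sub_log_eq hα (hπ s) (hπ₀ s)]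
  refine Finset.sum_congr rfl fun a _ => ?_
  simp only [qValue, regReward]
  ring

theorem IsValue.le_softMax {M : MOMDP S A m} [Nonempty A] {α : ℝ} (hα : 0 < α) {π π₀ : S → A → ℝ}
    (hπ : IsPolicy π) (hπ₀ : ∀ s a, 0 < π₀ s a) {R : S → A → ℝ} {V : S → ℝ}
    (hV : M.IsValue (regReward R α π₀ π) π V) (s : S) :
    V s ≤ softMax α (π₀ s) (M.qValue R V s) := by
  have h := hV s
  rw [M.sum_mul_qValue_regReward hα hπ hπ₀] at h
  have := mul_nonneg hα.le (kl_nonneg (hπ s) (gibbs_mem_stdSimplex hα (hπ₀ s) (M.qValue R V s))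
    (gibbs_pos (hπ₀ s) _))
  linarith

/-- One step of soft policy iteration, on the reachable states. -/
theorem softPolicyIteration_step [Nonempty A] {α : ℝ} (hα : 0 < α) {π π' π₀ : S → A → ℝ}
    (hπ : IsPolicy π) (hπ' : IsPolicy π') (hπ₀ : ∀ s a, 0 < π₀ s a)
    {R : S → A → ℝ} {V V' W : S → ℝ} (hV : M.IsValue (regReward R α π₀ π) π V)
    (hV' : M.IsValue (regReward R α π₀ π') π' V')
    (hW : ∀ s, W s = softMax α (π₀ s) (M.qValue R W s))
    (hstep : ∀ s, M.Reachable s → π' s = gibbs α (π₀ s) (M.qValue R V s)) {c : ℝ}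
    (hc : ∀ s, M.Reachable s → W s ≤ V s + c) (s : S) (hs : M.Reachable s) :
    W s ≤ V' s + M.γ * c := by
  have hcl : ∀ s, M.Reachable s → ∀ a s', 0 < M.P s a s' → s' ∈ {s | M.Reachable s} :=
    fun s hs a s' h => Reachable.step s a s' hs h
  have hsoft : ∀ s, M.Reachable s → softMax α (π₀ s) (M.qValue R V s) =
      ∑ a, π' s a * M.qValue (regReward R α π₀ π') V s a := by
    intro s hs
    rw [M.sum_mul_qValue_regReward hα hπ' hπ₀, hstep s hs, kl_self (gibbs_pos (hπ₀ s) _), mul_zero,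
      sub_zero]
  -- Policy improvement: `V` lies below its soft Bellman update, which is the update under `π'`, so
  -- `V - V'` is bounded by `γ` times its own maximum over reachable states.
  have hmono : ∀ s, M.Reachable s → V s ≤ V' s := by
    intro s hs
    have h := le_of_forall_le_add_mul (γ := M.γ) (b := 0) M.γ_lt_one (X := {s | M.Reachable s})
      (f := fun s => V s - V' s) (fun c hc s hs => ?_) hs
    · rw [zero_div] at h
      linarith
    · have h1 := hV.le_softMax hα hπ hπ₀ s
      rw [hsoft s hs] at h1
      have h2 := h1.trans (sum_mul_le_sum_mul_add (hπ' s) fun a =>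
        M.qValue_le (W := V') (c := c) (hcl s hs a) (fun s hs => by linarith [hc s hs]) _)
      rw [← hV' s] at h2
      linarith
  have h1 : W s ≤ softMax α (π₀ s) (M.qValue R V s) + M.γ * c := by
    rw [hW s]
    exact softMax_le hα (hπ₀ s) fun a => M.qValue_le (hcl s hs a) hc R
  have h2 : softMax α (π₀ s) (M.qValue R V s) ≤ V' s := by
    rw [hsoft s hs, hV' s]
    refine (sum_mul_le_sum_mul_add (c := M.γ * 0) (hπ' s) fun a =>
      M.qValue_le (W := V') (hcl s hs a) (fun s hs => ?_) _).trans_eq (by simp)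
    simpa using hmono s hs
  linarith

theorem policyKL_nonneg {d : S → ℝ} (hd : ∀ s, 0 ≤ d s) {π π' : S → A → ℝ} (hπ : IsPolicy π)
    (hπ' : IsPolicy π') (hpos : ∀ s a, 0 < π' s a) : 0 ≤ policyKL d π π' :=
  Finset.sum_nonneg fun s _ => mul_nonneg (hd s) (kl_nonneg (hπ s) (hπ' s) (hpos s))

variable [DecidableEq S]

/-- An exact three-point identity: the divergence from the Gibbs policy is the variational deficit.
On the right, `π` enters only through its visitation distribution, so two policies can be compared
by bounding the soft Bellman residual of `V`. -/
theorem valueInit_eq_softMax {α : ℝ} (hα : 0 < α) {π π' π₀ : S → A → ℝ}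
    (hπ : IsPolicy π) (hπ₀ : ∀ s a, 0 < π₀ s a) {R : S → A → ℝ} {V : S → ℝ}
    (hstep : ∀ s, M.Reachable s → π' s = gibbs α (π₀ s) (M.qValue R V s)) :
    M.valueInit R π - α / (1 - M.γ) * policyKL (M.stateVisitation π) π π₀ +
      α / (1 - M.γ) * policyKL (M.stateVisitation π) π π' =
    ∑ s, M.ρ s * V s + 1 / (1 - M.γ) *
      ∑ s, M.stateVisitation π s * (softMax α (π₀ s) (M.qValue R V s) - V s) := by
  have h := M.valueInit_sub hπ (regReward R α π₀ π) V
  rw [M.valueInit_regReward hπ, sub_eq_iff_eq_add] at h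
  have h1 : ∑ s, M.stateVisitation π s *
      (∑ a, π s a * M.qValue (regReward R α π₀ π) V s a - V s) =
      ∑ s, M.stateVisitation π s * (softMax α (π₀ s) (M.qValue R V s) - V s) -
        α * policyKL (M.stateVisitation π) π π' := by
    rw [policyKL, Finset.mul_sum, ← Finset.sum_sub_distrib]
    refine Finset.sum_congr rfl fun s _ => ?_
    by_cases hs : M.Reachable s
    · rw [M.sum_mul_qValue_regReward hα hπ hπ₀, hstep s hs]
      ring
    · simp [M.stateVisitation_eq_zero hπ hs]
  rw [h1] at h
  linear_combination h

variable [DecidableEq A]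

/-- The initial gap is at most `2 * L / (1 - γ)` because the anchor pays no KL cost, so its value is
at least `-L / (1 - γ)`, while `W` is at most `L / (1 - γ)`. Each step gains a factor `γ`. -/
theorem exists_isValue_innerLoop [Nonempty A] {α : ℝ} (hα : 0 < α) {R : S → A → ℝ} {L : ℝ}
    (hR : ∀ s a, |R s a| ≤ L) (θ₀ : S × A → ℝ) {W : S → ℝ}
    (hW : ∀ s, W s = softMax α (softmax θ₀ s) (M.qValue R W s)) (t : ℕ) :
    ∃ V, M.IsValue (regReward R α (softmax θ₀)
        (softmax (M.innerLoop R α ((1 - M.γ) / α) t θ₀)))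
        (softmax (M.innerLoop R α ((1 - M.γ) / α) t θ₀)) V ∧
      ∀ s, M.Reachable s → W s ≤ V s + M.γ ^ t * (2 * L / (1 - M.γ)) := by
  induction t with
  | zero =>
    obtain ⟨V, hV⟩ := M.exists_isValue (isPolicy_softmax θ₀)
      (regReward R α (softmax θ₀) (softmax θ₀))
    refine ⟨V, hV, fun s _ => ?_⟩
    have h1 := hV.ge (isPolicy_softmax θ₀) (b := -L) (fun s a => by
      rw [regReward, div_self (softmax_pos θ₀ s a).ne', Real.log_one, mul_zero, sub_zero]
      exact (abs_le.1 (hR s a)).1) s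
    have h2 := M.softValue_le hα (softmax_pos θ₀) (isPolicy_softmax θ₀) hW
      (fun s a => (abs_le.1 (hR s a)).2) s
    rw [neg_div] at h1
    rw [pow_zero, one_mul, two_mul, add_div]
    linarith
  | succ t ih =>
    obtain ⟨V, hV, hc⟩ := ih
    have hit : M.innerLoop R α ((1 - M.γ) / α) (t + 1) θ₀ =
        M.npgStep R α ((1 - M.γ) / α) θ₀ (M.innerLoop R α ((1 - M.γ) / α) t θ₀) :=
      Function.iterate_succ_apply' _ _ _
    rw [hit]
    obtain ⟨V', hV'⟩ := M.exists_isValue (isPolicy_softmax (M.npgStep R α ((1 - M.γ) / α) θ₀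
      (M.innerLoop R α ((1 - M.γ) / α) t θ₀))) (regReward R α (softmax θ₀) (softmax
        (M.npgStep R α ((1 - M.γ) / α) θ₀ (M.innerLoop R α ((1 - M.γ) / α) t θ₀))))
    refine ⟨V', hV', fun s hs => ?_⟩
    rw [pow_succ', mul_assoc]
    exact M.softPolicyIteration_step hα (isPolicy_softmax _) (isPolicy_softmax _) (softmax_pos θ₀)
      hV hV' hW (fun s hs => funext fun a => M.softmax_npgStep hα hV hs a) hc s hs

/-- The inner loop approximately performs a mirror ascent step. -/
theorem innerLoop_mirror_step [Nonempty A] {α : ℝ} (hα : 0 < α) {R : S → A → ℝ} {L : ℝ}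
    (hR : ∀ s a, |R s a| ≤ L) (θ₀ : S × A → ℝ) (t : ℕ) {θ : S × A → ℝ}
    (hθ : θ = M.innerLoop R α ((1 - M.γ) / α) (t + 1) θ₀) {π : S → A → ℝ} (hπ : IsPolicy π) :
    M.valueInit R π - α / (1 - M.γ) * policyKL (M.stateVisitation π) π (softmax θ₀) +
      α / (1 - M.γ) * policyKL (M.stateVisitation π) π (softmax θ) ≤
    M.valueInit R (softmax θ) - α / (1 - M.γ) *
      policyKL (M.stateVisitation (softmax θ)) (softmax θ) (softmax θ₀) +
      1 / (1 - M.γ) * (M.γ ^ t * (2 * L / (1 - M.γ))) := by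
  obtain ⟨W, hW⟩ := M.exists_softValue hα (softmax_pos θ₀) R
  -- Of the `t + 1` steps, the first `t` make `V` nearly soft-optimal and the last produces the
  -- Gibbs policy for that `V`; hence the exponent `t` in the error.
  obtain ⟨V, hV, hc⟩ := M.exists_isValue_innerLoop hα hR θ₀ hW t
  set θ₁ := M.innerLoop R α ((1 - M.γ) / α) t θ₀ with hθ₁
  set δ := M.γ ^ t * (2 * L / (1 - M.γ)) with hδ
  have hθ' : θ = M.npgStep R α ((1 - M.γ) / α) θ₀ θ₁ :=
    hθ.trans (Function.iterate_succ_apply' _ _ _)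
  have hstep : ∀ s, M.Reachable s →
      softmax θ s = gibbs α (softmax θ₀ s) (M.qValue R V s) := fun s hs => funext fun a => by
    rw [hθ']; exact M.softmax_npgStep hα hV hs a
  have hinv := (one_div_pos.2 M.one_sub_γ_pos).le
  have hVW : ∀ s, M.Reachable s → V s ≤ W s := by
    intro s hs
    have h := le_of_forall_le_add_mul (γ := M.γ) (b := 0) M.γ_lt_one (X := Set.univ)
      (f := fun s => V s - W s) (fun c hc s hs => ?_) (Set.mem_univ s)
    · rw [zero_div] at h
      linarith
    · have h1 := (hV.le_softMax hα (isPolicy_softmax θ₁) (softmax_pos θ₀) s).trans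
        (softMax_le hα (softmax_pos θ₀ s) fun a => M.qValue_le (W := W) (c := c) (X := Set.univ)
          (by simp) (fun s hs => by linarith [hc s hs]) R)
      rw [← hW s] at h1
      linarith
  -- On reachable states `V` is at most its soft Bellman update, which is at most `W`, so the
  -- residual lies between 0 and `δ`.
  have hup : ∀ s, M.Reachable s → softMax α (softmax θ₀ s) (M.qValue R V s) - V s ≤ δ := by
    intro s hs
    have h1 : softMax α (softmax θ₀ s) (M.qValue R V s) ≤ W s := by
      rw [hW s]
      refine (softMax_le (c := M.γ * 0) hα (softmax_pos θ₀ s) fun a => M.qValue_le (W := W)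
        (X := {s | M.Reachable s}) (fun s' h => Reachable.step s a s' hs h)
        (fun s hs => ?_) R).trans_eq (by simp)
      simpa using hVW s hs
    linarith [hc s hs]
  have e1 := M.valueInit_eq_softMax hα hπ (softmax_pos θ₀) hstep
  have e2 := M.valueInit_eq_softMax hα (isPolicy_softmax θ) (softmax_pos θ₀) hstep
  have e3 : policyKL (M.stateVisitation (softmax θ)) (softmax θ) (softmax θ) = 0 :=
    Finset.sum_eq_zero fun s _ => by rw [kl_self (softmax_pos θ s), mul_zero]
  rw [e3, mul_zero, add_zero] at e2
  have e4 : ∑ s, M.stateVisitation π s *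
      (softMax α (softmax θ₀ s) (M.qValue R V s) - V s) ≤ δ := by
    calc _ ≤ ∑ s, M.stateVisitation π s * δ := by
          refine Finset.sum_le_sum fun s _ => ?_
          by_cases hs : M.Reachable s
          · exact mul_le_mul_of_nonneg_left (hup s hs) (M.stateVisitation_nonneg hπ s)
          · simp [M.stateVisitation_eq_zero hπ hs]
      _ = δ := by rw [← Finset.sum_mul, M.sum_stateVisitation hπ, one_mul]
  have e5 : 0 ≤ ∑ s, M.stateVisitation (softmax θ) s *
      (softMax α (softmax θ₀ s) (M.qValue R V s) - V s) :=
    Finset.sum_nonneg fun s _ => mul_nonneg (M.stateVisitation_nonneg (isPolicy_softmax θ) s)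
      (sub_nonneg.2 (hV.le_softMax hα (isPolicy_softmax θ₁) (softmax_pos θ₀) s))
  rw [e1, e2]
  have e6 := mul_le_mul_of_nonneg_left e4 hinv
  have e7 := mul_nonneg hinv e5
  linarith

end MOMDP

/-! ### First-order bounds for the objective and one macro step -/

theorem ConcaveOn.sub_le_fderivWithin {E : Type*} [NormedAddCommGroup E] [NormedSpace ℝ E]
    {F : E → ℝ} {B : Set E} (hF : ConcaveOn ℝ B F) (hd : DifferentiableOn ℝ F B) {v w : E}
    (hv : v ∈ B) (hw : w ∈ B) : F w - F v ≤ fderivWithin ℝ F B v (w - v) := by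
  set g : ℝ →ᵃ[ℝ] E := AffineMap.lineMap v w with hg
  have h0 : g 0 = v := AffineMap.lineMap_apply_zero v w
  have h1 : g 1 = w := AffineMap.lineMap_apply_one v w
  have hd' : HasDerivWithinAt (F ∘ g) (fderivWithin ℝ F B v (w - v)) (g ⁻¹' B) 0 := by
    refine HasFDerivWithinAt.comp_hasDerivWithinAt (t := B) 0 ?_
      (AffineMap.hasDerivWithinAt_lineMap) (Set.mapsTo_preimage _ _)
    rw [h0]
    exact (hd v hv).hasFDerivWithinAt
  have h := (hF.comp_affineMap g).slope_le_of_hasDerivWithinAt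
    (by rwa [Set.mem_preimage, h0]) (by rwa [Set.mem_preimage, h1]) one_pos hd'
  rwa [slope_def_field, Function.comp_apply, Function.comp_apply, h0, h1, sub_zero, div_one] at h

theorem fderivWithin_apply_eq_sum {m : ℕ} (F : (Fin m → ℝ) → ℝ) (B : Set (Fin m → ℝ))
    (v x : Fin m → ℝ) : fderivWithin ℝ F B v x = ∑ i, coordGradWithin F B v i * x i := by
  rw [← ContinuousLinearMap.coe_coe (fderivWithin ℝ F B v), LinearMap.pi_apply_eq_sum_univ]
  refine Finset.sum_congr rfl fun i _ => ?_
  have hi : Pi.single i 1 = fun j => if i = j then (1 : ℝ) else 0 := by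
    ext j
    simp [Pi.single_apply, eq_comm]
  rw [coordGradWithin, smul_eq_mul, mul_comm, hi]
  rfl

/-- The tangent inequality is taken at `w` and its gradient is then replaced by the one at `v`. This
avoids integrating along the segment and costs only `β` in place of `β / 2`. -/
theorem ConcaveOn.ge_of_coordGradWithin_lipschitz {m : ℕ} {F : (Fin m → ℝ) → ℝ}
    {B : Set (Fin m → ℝ)} (hF : ConcaveOn ℝ B F) (hd : DifferentiableOn ℝ F B) {β : ℝ}
    (hβ : ∀ v ∈ B, ∀ w ∈ B,
      ∑ i, |coordGradWithin F B v i - coordGradWithin F B w i| ≤ β * ‖v - w‖)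
    {v w : Fin m → ℝ} (hv : v ∈ B) (hw : w ∈ B) :
    F v + ∑ i, coordGradWithin F B v i * (w i - v i) - β * ‖w - v‖ ^ 2 ≤ F w := by
  have h1 := hF.sub_le_fderivWithin hd hw hv
  rw [fderivWithin_apply_eq_sum] at h1
  have h2 : ∑ i, (coordGradWithin F B v i - coordGradWithin F B w i) * (w i - v i) ≤
      β * ‖w - v‖ ^ 2 := by
    calc _ ≤ ∑ i, |coordGradWithin F B v i - coordGradWithin F B w i| * ‖w - v‖ := by
          refine Finset.sum_le_sum fun i _ => (le_abs_self _).trans ?_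
          rw [abs_mul]
          exact mul_le_mul_of_nonneg_left (norm_le_pi_norm (w - v) i) (abs_nonneg _)
      _ ≤ β * ‖v - w‖ * ‖w - v‖ := by
          rw [← Finset.sum_mul]
          exact mul_le_mul_of_nonneg_right (hβ v hv w hw) (norm_nonneg _)
      _ = β * ‖w - v‖ ^ 2 := by rw [norm_sub_rev]; ring
  have h3 : ∑ i, (coordGradWithin F B v i - coordGradWithin F B w i) * (w i - v i) =
      ∑ i, coordGradWithin F B v i * (w i - v i) +
      ∑ i, coordGradWithin F B w i * (v - w) i := by
    rw [← Finset.sum_add_distrib]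
    exact Finset.sum_congr rfl fun i _ => by rw [Pi.sub_apply]; ring
  linarith

namespace MOMDP

variable {S A : Type*} [Fintype S] [Fintype A] [DecidableEq S] {m : ℕ} (M : MOMDP S A m)

theorem valueInit_mem_Icc {π : S → A → ℝ} (hπ : IsPolicy π) {R : S → A → ℝ}
    (hR : ∀ s a, R s a ∈ Set.Icc (0 : ℝ) 1) :
    M.valueInit R π ∈ Set.Icc 0 (1 / (1 - M.γ)) := by
  have hinv := (one_div_pos.2 M.one_sub_γ_pos).le
  rw [M.valueInit_eq hπ]
  have h1 : ∀ s, 0 ≤ ∑ a, π s a * R s a := fun s =>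
    Finset.sum_nonneg fun a _ => mul_nonneg ((hπ s).1 a) (hR s a).1
  have h2 : ∀ s, ∑ a, π s a * R s a ≤ 1 := fun s => by
    rw [← (hπ s).2]
    exact Finset.sum_le_sum fun a _ => mul_le_of_le_one_right ((hπ s).1 a) (hR s a).2
  refine ⟨mul_nonneg hinv (Finset.sum_nonneg fun s _ =>
    mul_nonneg (M.stateVisitation_nonneg hπ s) (h1 s)), mul_le_of_le_one_right hinv ?_⟩
  rw [← M.sum_stateVisitation hπ]
  exact Finset.sum_le_sum fun s _ =>
    mul_le_of_le_one_right (M.stateVisitation_nonneg hπ s) (h2 s)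

theorem valueVec_mem_valueBox {π : S → A → ℝ} (hπ : IsPolicy π) : M.valueVec π ∈ M.valueBox :=
  ⟨fun i => (M.valueInit_mem_Icc hπ (M.r_mem i)).1, fun i => (M.valueInit_mem_Icc hπ (M.r_mem i)).2⟩

/-- The value difference is a visitation average of expected advantages, each controlled by the KL
divergence at that state. Of the four powers of `1 / (1 - γ)`, two come from normalizing the
visitation and two from the range of the action values. -/
theorem sq_valueInit_sub_le {π π' : S → A → ℝ} (hπ : IsPolicy π) (hπ' : IsPolicy π')
    (hpos : ∀ s a, 0 < π s a) {R : S → A → ℝ} (hR : ∀ s a, R s a ∈ Set.Icc (0 : ℝ) 1) :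
    (M.valueInit R π' - M.valueInit R π) ^ 2 ≤
      policyKL (M.stateVisitation π') π' π / (1 - M.γ) ^ 4 := by
  obtain ⟨V, hV⟩ := M.exists_isValue hπ R
  have hq := M.one_sub_γ_pos
  have e1 := M.valueInit_sub hπ R V
  simp only [← hV _, sub_self, mul_zero, Finset.sum_const_zero] at e1
  have e2 := M.valueInit_sub hπ' R V
  set B := 1 / (1 - M.γ) with hB
  have hB0 : 0 < B := one_div_pos.2 hq
  -- Centring at the midpoint halves the sup norm; after squaring, this cancels the 4 in
  -- `kl_ge_sq_abs`.
  have hQ : ∀ s a, |M.qValue R V s a - B / 2| ≤ B / 2 := by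
    intro s a
    have hV0 : ∀ s, 0 ≤ V s := fun s => by
      simpa using hV.ge hπ (b := 0) (fun s a => (hR s a).1) s
    have hV1 : ∀ s, V s ≤ B := fun s => hV.le hπ (fun s a => (hR s a).2) s
    have h0 := M.next_le (X := Set.univ) (s := s) (a := a) (by simp) (V := 0) (W := V) (c := 0)
      (by simpa using hV0)
    have h1 := M.next_le (X := Set.univ) (s := s) (a := a) (by simp) (V := V) (W := 0) (c := B)
      (by simpa using hV1)
    simp only [next, Pi.zero_apply, mul_zero, Finset.sum_const_zero, zero_add, add_zero] at h0 h1
    have h2 := hR s a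
    have h3 := mul_nonneg M.γ_pos.le h0
    have h4 := mul_le_mul_of_nonneg_left h1 M.γ_pos.le
    have h5 : 1 + M.γ * B = B := by rw [hB]; field_simp; ring
    rw [abs_le, qValue, next]
    constructor <;> linarith [h2.1, h2.2]
  have hx : ∀ s, (∑ a, π' s a * M.qValue R V s a - V s) ^ 2 ≤ B ^ 2 * kl (π' s) (π s) := by
    intro s
    have h1 : ∑ a, π' s a * M.qValue R V s a - V s =
        ∑ a, (π' s a - π s a) * (M.qValue R V s a - B / 2) := by
      rw [hV s]
      simp only [sub_mul, mul_sub, Finset.sum_sub_distrib, ← Finset.sum_mul, (hπ s).2, (hπ' s).2]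
      ring
    have h2 : |∑ a, π' s a * M.qValue R V s a - V s| ≤ (∑ a, |π' s a - π s a|) * (B / 2) := by
      rw [h1, Finset.sum_mul]
      refine (Finset.abs_sum_le_sum_abs _ _).trans (Finset.sum_le_sum fun a _ => ?_)
      rw [abs_mul]
      exact mul_le_mul_of_nonneg_left (hQ s a) (abs_nonneg _)
    have h3 := pow_le_pow_left₀ (abs_nonneg _) h2 2
    rw [sq_abs] at h3
    have h4 := kl_ge_sq_abs (hπ' s) (hπ s) (hpos s)
    have h5 := mul_le_mul_of_nonneg_right h4 (sq_nonneg (B / 2))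
    nlinarith
  -- Jensen's inequality for the square under the visitation distribution.
  have hJ : (∑ s, M.stateVisitation π' s * (∑ a, π' s a * M.qValue R V s a - V s)) ^ 2 ≤
      ∑ s, M.stateVisitation π' s * (∑ a, π' s a * M.qValue R V s a - V s) ^ 2 :=
    (even_two.convexOn_pow (𝕜 := ℝ)).map_sum_le (fun s _ => M.stateVisitation_nonneg hπ' s)
      (M.sum_stateVisitation hπ') fun s _ => Set.mem_univ _
  have hK : ∑ s, M.stateVisitation π' s * (∑ a, π' s a * M.qValue R V s a - V s) ^ 2 ≤
      B ^ 2 * policyKL (M.stateVisitation π') π' π := by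
    rw [policyKL, Finset.mul_sum]
    refine Finset.sum_le_sum fun s _ => ?_
    rw [mul_left_comm]
    exact mul_le_mul_of_nonneg_left (hx s) (M.stateVisitation_nonneg hπ' s)
  have e3 : M.valueInit R π' - M.valueInit R π =
      B * ∑ s, M.stateVisitation π' s * (∑ a, π' s a * M.qValue R V s a - V s) := by
    linarith
  rw [e3, mul_pow]
  refine (mul_le_mul_of_nonneg_left (hJ.trans hK) (sq_nonneg B)).trans_eq ?_
  rw [hB]
  field_simp

theorem sq_norm_valueVec_sub_le {π π' : S → A → ℝ} (hπ : IsPolicy π) (hπ' : IsPolicy π')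
    (hpos : ∀ s a, 0 < π s a) : ‖M.valueVec π' - M.valueVec π‖ ^ 2 ≤
      policyKL (M.stateVisitation π') π' π / (1 - M.γ) ^ 4 := by
  have h0 : 0 ≤ policyKL (M.stateVisitation π') π' π / (1 - M.γ) ^ 4 :=
    div_nonneg (policyKL_nonneg (M.stateVisitation_nonneg hπ') hπ' hπ hpos)
      (pow_nonneg M.one_sub_γ_pos.le 4)
  have h1 : ‖M.valueVec π' - M.valueVec π‖ ≤
      √(policyKL (M.stateVisitation π') π' π / (1 - M.γ) ^ 4) :=
    (pi_norm_le_iff_of_nonneg (Real.sqrt_nonneg _)).2 fun i =>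
      Real.abs_le_sqrt (M.sq_valueInit_sub_le hπ hπ' hpos (M.r_mem i))
  exact (pow_le_pow_left₀ (norm_nonneg _) h1 2).trans_eq (Real.sq_sqrt h0)

/-- Values are linear in the reward, so improving the ascent reward means improving the
linearization of `F` at the current value vector. -/
theorem valueInit_ascentReward (F : (Fin m → ℝ) → ℝ) (θ : S × A → ℝ) {π : S → A → ℝ}
    (hπ : IsPolicy π) : M.valueInit (M.ascentReward F θ) π =
      ∑ i, coordGradWithin F M.valueBox (M.valueVec (softmax θ)) i * M.valueVec π i := by
  simp only [valueVec, M.valueInit_eq hπ, ascentReward, Finset.mul_sum]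
  symm
  rw [Finset.sum_comm]
  refine Finset.sum_congr rfl fun s _ => ?_
  rw [Finset.sum_comm]
  exact Finset.sum_congr rfl fun a _ => Finset.sum_congr rfl fun i _ => by ring

theorem abs_ascentReward_le {F : (Fin m → ℝ) → ℝ} {θ : S × A → ℝ} {L : ℝ}
    (hL : ∑ i, |coordGradWithin F M.valueBox (M.valueVec (softmax θ)) i| ≤ L) (s : S) (a : A) :
    |M.ascentReward F θ s a| ≤ L := by
  refine ((Finset.abs_sum_le_sum_abs _ _).trans (Finset.sum_le_sum fun i _ => ?_)).trans hL
  rw [abs_mul, abs_of_nonneg (M.r_mem i s a).1]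
  exact mul_le_of_le_one_right (abs_nonneg _) (M.r_mem i s a).2

variable [DecidableEq A]

/-- The optimality gap after one macro step. -/
theorem macroStep_gap_le [Nonempty A] {F : (Fin m → ℝ) → ℝ} {α β L : ℝ}
    (hF : ConcaveOn ℝ M.valueBox F) (hd : DifferentiableOn ℝ F M.valueBox) (hβ0 : 0 < β)
    (hβ : ∀ v ∈ M.valueBox, ∀ v' ∈ M.valueBox,
      ∑ i, |coordGradWithin F M.valueBox v i - coordGradWithin F M.valueBox v' i| ≤ β * ‖v - v'‖)
    (hL : ∀ v ∈ M.valueBox, ∑ i, |coordGradWithin F M.valueBox v i| ≤ L)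
    (hα : β / (1 - M.γ) ^ 3 ≤ α) (θ₀ : S × A → ℝ) (t : ℕ) {θ : S × A → ℝ}
    (hθ : θ = M.innerLoop (M.ascentReward F θ₀) α ((1 - M.γ) / α) (t + 1) θ₀)
    {π : S → A → ℝ} (hπ : IsPolicy π) :
    F (M.valueVec π) - F (M.valueVec (softmax θ)) ≤
      α / (1 - M.γ) * (policyKL (M.stateVisitation π) π (softmax θ₀) -
        policyKL (M.stateVisitation π) π (softmax θ)) +
      1 / (1 - M.γ) * (M.γ ^ t * (2 * L / (1 - M.γ))) := by
  have hq := M.one_sub_γ_pos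
  have hα0 : 0 < α := (by positivity : 0 < β / (1 - M.γ) ^ 3).trans_le hα
  have hb : ∀ {π}, IsPolicy π → M.valueVec π ∈ M.valueBox := fun h => M.valueVec_mem_valueBox h
  have h0 := isPolicy_softmax θ₀
  have h1 := isPolicy_softmax θ
  have e1 := M.innerLoop_mirror_step hα0 (M.abs_ascentReward_le (hL _ (hb h0))) θ₀ t hθ hπ
  have e2 := hF.sub_le_fderivWithin hd (hb h0) (hb hπ)
  have e3 := hF.ge_of_coordGradWithin_lipschitz hd hβ (hb h0) (hb h1)
  rw [fderivWithin_apply_eq_sum] at e2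
  simp only [Pi.sub_apply, mul_sub, Finset.sum_sub_distrib, ← M.valueInit_ascentReward F θ₀ hπ,
    ← M.valueInit_ascentReward F θ₀ h0, ← M.valueInit_ascentReward F θ₀ h1] at e2 e3
  -- The lower bound on `α` is exactly what lets the regularizer absorb the second-order loss of
  -- `F`.
  have e4 : β * ‖M.valueVec (softmax θ) - M.valueVec (softmax θ₀)‖ ^ 2 ≤
      α / (1 - M.γ) * policyKL (M.stateVisitation (softmax θ)) (softmax θ) (softmax θ₀) := by
    have hD := policyKL_nonneg (M.stateVisitation_nonneg h1) h1 h0 (softmax_pos θ₀)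
    calc _ ≤ β * (policyKL (M.stateVisitation (softmax θ)) (softmax θ) (softmax θ₀) /
          (1 - M.γ) ^ 4) :=
          mul_le_mul_of_nonneg_left (M.sq_norm_valueVec_sub_le h0 h1 (softmax_pos θ₀)) hβ0.le
      _ = β / (1 - M.γ) ^ 3 / (1 - M.γ) *
          policyKL (M.stateVisitation (softmax θ)) (softmax θ) (softmax θ₀) := by
          field_simp
      _ ≤ _ := by gcongr
  linarith

end MOMDP

/-! ### Iteration counts and the final rate -/

theorem pow_le_inv_of_log_div_le {γ x : ℝ} (h0 : 0 ≤ γ) (h1 : γ < 1) (hx : 0 < x) {t : ℕ}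
    (ht : 1 / (1 - γ) * Real.log x ≤ t) : γ ^ t ≤ x⁻¹ := by
  have h2 : γ ≤ Real.exp (-(1 - γ)) := by linarith [Real.add_one_le_exp (-(1 - γ))]
  refine (pow_le_pow_left₀ h0 h2 t).trans ?_
  rw [← Real.exp_nat_mul, ← Real.exp_log (inv_pos.2 hx), Real.exp_le_exp, Real.log_inv]
  rw [one_div, inv_mul_le_iff₀ (sub_pos.2 h1)] at ht
  linarith

/-- `L ≤ κ * β` and `K ≤ K * t` bound the logarithm by a constant plus `log T`, where `T = K * t`;
since `T ≥ 2`, the constants are absorbed into a multiple of `log T` at the price of dividing by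
`log 2`. -/
theorem ceil_innerSteps_le {q L β κ N : ℝ} (hq : 0 < q) (hq1 : q ≤ 1) (hL : 0 < L) (hβ : 0 < β)
    (hN : 0 < N) (hκ : L ≤ κ * β) {K t : ℕ} (hK : 1 ≤ K)
    (ht : t = ⌈1 / q * Real.log (5 * L * K / (β * N)) + 1⌉₊) (hT : 2 ≤ K * t) :
    (t : ℝ) ≤ (1 + (|Real.log (5 * κ / N)| + 2) / Real.log 2) * Real.log ((K * t : ℕ) : ℝ) / q := by
  have ht0 : 0 < t := by
    rcases Nat.eq_zero_or_pos t with h | h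
    · simp [h] at hT
    · exact h
  have hK0 : (0 : ℝ) < K := by exact_mod_cast hK
  have h1 : (t : ℝ) < 1 / q * Real.log (5 * L * K / (β * N)) + 1 + 1 := by
    have := Nat.ceil_pos.1 (ht ▸ ht0)
    rw [ht]
    exact Nat.ceil_lt_add_one this.le
  have hκ0 : 0 < κ := pos_of_mul_pos_left (hL.trans_le hκ) hβ.le
  have h2 : Real.log (5 * L * K / (β * N)) ≤ |Real.log (5 * κ / N)| + Real.log ((K * t : ℕ) : ℝ) := by
    have e : 5 * L * K / (β * N) ≤ 5 * κ / N * K := by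
      rw [div_mul_eq_mul_div, div_le_div_iff₀ (by positivity) hN]
      have := mul_le_mul_of_nonneg_right hκ (by positivity : 0 ≤ 5 * K * N)
      nlinarith
    have e1 := Real.log_le_log (by positivity) e
    rw [Real.log_mul (by positivity) hK0.ne'] at e1
    have e2 : Real.log K ≤ Real.log ((K * t : ℕ) : ℝ) :=
      Real.log_le_log hK0 (by exact_mod_cast Nat.le_mul_of_pos_right K ht0)
    linarith [le_abs_self (Real.log (5 * κ / N))]
  have hlog2 : 0 < Real.log 2 := Real.log_pos one_lt_two
  have h3 : Real.log 2 ≤ Real.log ((K * t : ℕ) : ℝ) :=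
    Real.log_le_log two_pos (by exact_mod_cast hT)
  have h4 : |Real.log (5 * κ / N)| + 2 ≤
      (|Real.log (5 * κ / N)| + 2) / Real.log 2 * Real.log ((K * t : ℕ) : ℝ) := by
    rw [div_mul_eq_mul_div, le_div_iff₀ hlog2]
    exact mul_le_mul_of_nonneg_left h3 (by positivity)
  rw [le_div_iff₀ hq]
  have h5 : 1 / q * Real.log (5 * L * K / (β * N)) * q = Real.log (5 * L * K / (β * N)) := by
    field_simp
  nlinarith

theorem corollary1 (nA : ℕ) (hnA : 2 ≤ nA) (κ c : ℝ) (hκ : 0 < κ) (hc : 1 ≤ c) :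
    ∃ C : ℝ, 0 < C ∧
      ∀ (S A : Type*) [Fintype S] [Fintype A] [DecidableEq S] [DecidableEq A]
        (m : ℕ) (M : MOMDP S A m) (F : (Fin m → ℝ) → ℝ) (β L α η : ℝ) (K : ℕ) (t : ℕ → ℕ)
        (θ₀ : S × A → ℝ) (πstar : S → A → ℝ),
        Fintype.card A = nA →
        -- `F` is concave, and `β`-smooth with respect to the sup norm, on `[0, 1/(1-γ)]^m`
        ConcaveOn ℝ M.valueBox F →
        DifferentiableOn ℝ F M.valueBox →
        0 < β →
        (∀ v ∈ M.valueBox, ∀ v' ∈ M.valueBox,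
          ∑ i, |coordGradWithin F M.valueBox v i - coordGradWithin F M.valueBox v' i|
            ≤ β * ‖v - v'‖) →
        -- the gradient of `F` is bounded by `L` in the 1-norm
        0 < L →
        (∀ v ∈ M.valueBox, ∑ i, |coordGradWithin F M.valueBox v i| ≤ L) →
        L ≤ κ * β →
        -- the parameters of the algorithm
        1 ≤ K →
        (∀ s a, softmax θ₀ s a = 1 / (Fintype.card A : ℝ)) →
        β / (1 - M.γ) ^ 3 ≤ α →
        α ≤ c * (β / (1 - M.γ) ^ 3) →
        η = (1 - M.γ) / α →
        (∀ k, k < K → t k =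
          ⌈1 / (1 - M.γ) * Real.log (5 * L * K / (β * Real.log (Fintype.card A))) + 1⌉₊) →
        M.IsOptimal F πstar →
        2 ≤ ∑ k ∈ Finset.range K, t k →
        F (M.valueVec πstar) -
            1 / (K : ℝ) * ∑ k ∈ Finset.Icc 1 K,
              F (M.valueVec (softmax (M.arnpgIMD F α η t θ₀ k)))
          ≤ C * (β * Real.log ((∑ k ∈ Finset.range K, t k : ℕ) : ℝ) /
              ((1 - M.γ) ^ 5 * ((∑ k ∈ Finset.range K, t k : ℕ) : ℝ))) := by
  have hN : 0 < Real.log nA := Real.log_pos (by exact_mod_cast hnA)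
  have hlog2 : 0 < Real.log 2 := Real.log_pos one_lt_two
  -- In `c + 1`, the `c` pays for the initial divergence and the 1 for the inner-loop errors; the
  -- last factor comes from `ceil_innerSteps_le`.
  refine ⟨(c + 1) * Real.log nA * (1 + (|Real.log (5 * κ / Real.log nA)| + 2) / Real.log 2),
    by positivity, ?_⟩
  intro S A _ _ _ _ m M F β L α η K t θ₀ πstar hA hF hd hβ0 hβ hL0 hL hLκ hK hθ₀ hα hαc hη ht
    hopt hT
  have : Nonempty A := Fintype.card_pos_iff.1 (by omega)
  rw [hA] at ht
  set q := 1 - M.γ with hqdef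
  have hq : 0 < q := M.one_sub_γ_pos
  have hq1 : q ≤ 1 := by linarith [M.γ_pos]
  set N := Real.log nA with hNdef
  obtain ⟨t₀, ht₀⟩ : ∃ t₀, t₀ = ⌈1 / q * Real.log (5 * L * K / (β * N)) + 1⌉₊ := ⟨_, rfl⟩
  simp only [← ht₀] at ht
  have hsum : ∑ k ∈ Finset.range K, t k = K * t₀ := by
    rw [Finset.sum_congr rfl fun k hk => ht k (Finset.mem_range.1 hk), Finset.sum_const,
      Finset.card_range, smul_eq_mul]
  rw [hsum] at hT ⊢
  have hK0 : (0 : ℝ) < K := by exact_mod_cast hK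
  have hsteps := ceil_innerSteps_le hq hq1 hL0 hβ0 hN hLκ hK ht₀ hT
  obtain ⟨t₁, rfl⟩ : ∃ t₁, t₀ = t₁ + 1 := Nat.exists_eq_succ_of_ne_zero (by rintro rfl; simp at hT)
  have hx : 0 < 5 * L * K / (β * N) := by positivity
  -- The `+ 1` in the prescribed number of steps pays for the final Gibbs step, leaving `t₁`
  -- contracting ones.
  have hpow : M.γ ^ t₁ ≤ (5 * L * K / (β * N))⁻¹ := by
    refine pow_le_inv_of_log_div_le M.γ_pos.le M.γ_lt_one hx ?_
    have := Nat.le_ceil (1 / q * Real.log (5 * L * K / (β * N)) + 1)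
    rw [← ht₀] at this
    push_cast at this
    linarith
  set θ := M.arnpgIMD F α η t θ₀ with hθ
  set D : ℕ → ℝ := fun k => policyKL (M.stateVisitation πstar) πstar (softmax (θ k)) with hD
  -- Scaled so that `K * ε` equals `α / q * N` at the smallest admissible `α`, which puts the
  -- initial divergence and the inner-loop errors on the same footing.
  set ε := β * N / (q ^ 4 * K) with hε
  -- The choice of `t₁` makes the error at most `2 / 5 * q ^ 2 * ε`.
  have herr : 1 / q * (M.γ ^ t₁ * (2 * L / q)) ≤ ε := by
    calc _ ≤ 1 / q * ((5 * L * K / (β * N))⁻¹ * (2 * L / q)) := by gcongr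
      _ = 2 / 5 * q ^ 2 * ε := by rw [hε]; field_simp
      _ ≤ 1 * ε := by
          have : 0 < ε := by positivity
          gcongr
          nlinarith
      _ = ε := one_mul ε
  have hgap : ∀ k ∈ Finset.range K, F (M.valueVec πstar) - F (M.valueVec (softmax (θ (k + 1)))) ≤
      α / q * (D k - D (k + 1)) + ε := by
    intro k hk
    have hk' : θ (k + 1) = M.innerLoop (M.ascentReward F (θ k)) α ((1 - M.γ) / α) (t₁ + 1) (θ k) := by
      rw [← hqdef, ← hη, ← ht k (Finset.mem_range.1 hk)]
      rfl
    exact (M.macroStep_gap_le hF hd hβ0 hβ hL hα (θ k) t₁ hk' hopt.1).trans (by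
      rw [← hqdef]; linarith)
  have htel := Finset.sum_le_sum hgap
  rw [Finset.sum_sub_distrib, Finset.sum_add_distrib, ← Finset.mul_sum, Finset.sum_range_sub',
    Finset.sum_const, Finset.sum_const, Finset.card_range, nsmul_eq_mul, nsmul_eq_mul] at htel
  have hIcc : ∑ k ∈ Finset.Icc 1 K, F (M.valueVec (softmax (θ k))) =
      ∑ k ∈ Finset.range K, F (M.valueVec (softmax (θ (k + 1)))) := by
    rw [Finset.range_eq_Ico, Finset.sum_Ico_add' (fun k => F (M.valueVec (softmax (θ k)))) 0 K 1]
    rfl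
  have hD0 : D 0 ≤ N := by
    calc D 0 ≤ ∑ s, M.stateVisitation πstar s * N := by
          refine Finset.sum_le_sum fun s _ =>
            mul_le_mul_of_nonneg_left ?_ (M.stateVisitation_nonneg hopt.1 s)
          rw [hNdef, ← hA]
          exact kl_uniform_le (hopt.1 s) Fintype.card_pos (hθ₀ s)
      _ = N := by rw [← Finset.sum_mul, M.sum_stateVisitation hopt.1, one_mul]
  have hDK : 0 ≤ D K := MOMDP.policyKL_nonneg (M.stateVisitation_nonneg hopt.1) hopt.1
    (isPolicy_softmax _) (softmax_pos _)
  have hα0 : 0 < α := (by positivity : 0 < β / q ^ 3).trans_le hα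
  have hαq : α / q * (D 0 - D K) ≤ c * (K * ε) := by
    calc α / q * (D 0 - D K) ≤ α / q * N := by
          gcongr
          linarith
      _ ≤ c * (β / q ^ 3) / q * N := by gcongr
      _ = c * (K * ε) := by rw [hε]; field_simp
  rw [hIcc]
  calc _ = 1 / (K : ℝ) * (K * F (M.valueVec πstar) -
          ∑ k ∈ Finset.range K, F (M.valueVec (softmax (θ (k + 1))))) := by field_simp
    _ ≤ 1 / (K : ℝ) * (c * (K * ε) + K * ε) := by gcongr; linarith
    -- Multiplying and dividing by the inner count turns `K` into the total number of iterations
    -- `T`.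
    _ = (c + 1) * N * β / q ^ 4 / (K * (t₁ + 1 : ℕ)) * (t₁ + 1 : ℕ) := by
        rw [hε]; push_cast; field_simp
    _ ≤ (c + 1) * N * β / q ^ 4 / (K * (t₁ + 1 : ℕ)) *
        ((1 + (|Real.log (5 * κ / N)| + 2) / Real.log 2) *
          Real.log ((K * (t₁ + 1) : ℕ) : ℝ) / q) := by gcongr
    _ = _ := by
        push_cast
        field_simp
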